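/- All rings are commutative with unit. **Conventions.** A *basic setup* $(R,I)$ is a ring $R$ with an ideal $I\subset R$ such that $I=I^2$ and $I$ is a flat $R$-module. Let $A$ be an $R$-algebra and $M$ an $A$-module; $I$ acts on $A$-modules through $R\to A$. - $M$ is *$I$-almost finitely generated* (resp. *$I$-almost finitely presented*) over $A$ if for every finitely generated ideal $I_0\subset R$ with $I_0\subset I$ there is a finitely generated $A$-submodule $N\subset M$ with $I_0M\subset N$ (resp. there is an $A$-linear map $N\to M$ with $N$ a finitely presented $A$-module whose kernel and cokernel are annihilated by $I_0$). - $M$ is *$I$-almost projective* over $A$ if for every surjection $X\to Y$ of $A$-modules the cokernel of $\mathrm{Hom}_A(M,X)\to \mathrm{Hom}_A(M,Y)$ is annihilated by $I$. It is *$I$-almost flat* over $A$ if for every injection $X\to Y$ of $A$-modules the kernel of $M\otimes_AX\to M\otimes_AY$ is annihilated by $I$. - A homomorphism of $R$-algebras $A\to B$ is *$I$-almost finite étale* if $B$ is $I$-almost flat and $I$-almost finitely presented as an $A$-module, and $B$ is $I$-almost projective as a $B\otimes_AB$-module via the multiplication map $B\otimes_AB\to B$. Let $f_0:A_0\to B_0$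 be a ring homomorphism and $I_0\subset A_0$, $J_0\subset B_0$ ideals. We say that $f_0:(A_0,I_0)\to (B_0,J_0)$ *satisfies $(*)$* if there is $t\in A_0$ with $I_0=tA_0$ and $J_0=tB_0$ such that - (a) $(A_0,I_0)$ is *preuniform*: there are a nonzerodivisor $s\in A_0$ with $I_0=sA_0$ and an integer $c>0$ such that $s^c x$ lies in the image of $A_0$ for every $x\in A_0[\frac1s]$ that is integral over $A_0$; - (b) the induced ring map $A_0[\frac1t]\to B_0[\frac1t]$ is finite étale; - (c) $B_0$ is $t$-torsion free, and every element $b$ of $B_0$ is almost integral over $A_0$ in $B_0[\frac1t]$, that is, $\sum_{n\ge 0}A_0b^n$ is contained in a finitely generated $A_0$-submodule of $B_0[\frac1t]$. **Theorem.** Let $(R,I)$ be a basic setup, let $f_0:A_0\to B_0$ be a homomorphism of $R$-algebras and let $t\in A_0$. Denote by $\widehat{A_0}=\varprojlim_n A_0/t^nA_0$ and $\widehat{B_0}=\varprojlim_n B_0/t^nB_0$ the $t$-adic completions and by $\widehat{f_0}:\widehat{A_0}\to\widehat{B_0}$ the $R$-algebra homomorphism induced by $f_0$. Assume that $f_0:(A_0,(t))\to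 (B_0,(t))$ satisfies $(*)$. Then: 1. $B_0$ is $I$-almost finitely generated and $I$-almost projective over $A_0$ if and only if $\widehat{B_0}$ is $I$-almost finitely generated and $I$-almost projective over $\widehat{A_0}$. 2. $f_0:A_0\to B_0$ is $I$-almost finite étale if and only if $\widehat{f_0}:\widehat{A_0}\to\widehat{B_0}$ is $I$-almost finite étale. -/

import Mathlib

open scoped TensorProduct

universe uR uA uB uM

namespace AlmostPurity

/-! ### Basic setups and almost modules -/

/-- A basic setup `(R, I)`: an ideal `I` with `I = I ^ 2` which is flat as an `R`-module. -/
structure IsBasicSetup {R : Type uR} [CommRing R] (I : Ideal R) : Prop where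
  idempotent : I = I ^ 2
  flat : Module.Flat R I

section Modules

variable {R : Type uR} [CommRing R] (I : Ideal R)
variable (A : Type uA) [CommRing A] [Algebra R A]
variable (M : Type uM) [AddCommGroup M] [Module A M]

/-- `M` is `I`-almost finitely generated over the `R`-algebra `A`: for every finitely generated
ideal `I₀ ⊆ I` there is a finitely generated submodule of `M` which contains `I₀ M`. -/
def IsAlmostFinitelyGenerated : Prop :=
  ∀ I₀ : Ideal R, I₀.FG → I₀ ≤ I →
    ∃ N : Submodule A M, N.FG ∧ ∀ ε ∈ I₀, ∀ m : M, algebraMap R A ε • m ∈ N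

/-- `M` is `I`-almost finitely presented over the `R`-algebra `A`: for every finitely generated
ideal `I₀ ⊆ I` there is a linear map from a finitely presented `A`-module to `M` whose kernel and
cokernel are annihilated by `I₀`. -/
def IsAlmostFinitelyPresented : Prop :=
  ∀ I₀ : Ideal R, I₀.FG → I₀ ≤ I →
    ∃ (N : Type uA) (_ : AddCommGroup N) (_ : Module A N) (φ : N →ₗ[A] M),
      Module.FinitePresentation A N ∧
      (∀ ε ∈ I₀, ∀ n : N, φ n = 0 → algebraMap R A ε • n = 0) ∧
      (∀ ε ∈ I₀, ∀ m : M, algebraMap R A ε • m ∈ LinearMap.range φ)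

/-- `M` is `I`-almost projective over the `R`-algebra `A`: the functor `Hom_A(M, -)` is exact up
to `I`-almost zero modules. Since it is left exact, this says that for every surjection `X → Y`
of `A`-modules the cokernel of `Hom_A(M, X) → Hom_A(M, Y)` is annihilated by `I`. -/
def IsAlmostProjective : Prop :=
  ∀ (X Y : Type (max uA uM)) [AddCommGroup X] [Module A X] [AddCommGroup Y] [Module A Y]
    (p : X →ₗ[A] Y), Function.Surjective p →
    ∀ g : M →ₗ[A] Y, ∀ ε ∈ I, ∃ h : M →ₗ[A] X, p ∘ₗ h = algebraMap R A ε • g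

/-- `M` is `I`-almost flat over the `R`-algebra `A`: the functor `M ⊗_A -` is exact up to
`I`-almost zero modules. Since it is right exact, this says that for every injection `X → Y`
of `A`-modules the kernel of `M ⊗_A X → M ⊗_A Y` is annihilated by `I`. -/
def IsAlmostFlat : Prop :=
  ∀ (X Y : Type (max uA uM)) [AddCommGroup X] [Module A X] [AddCommGroup Y] [Module A Y]
    (i : X →ₗ[A] Y), Function.Injective i →
    ∀ x : M ⊗[A] X, i.lTensor M x = 0 → ∀ ε ∈ I, algebraMap R A ε • x = 0

end Modules

/-! ### Almost finite étale homomorphisms -/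

section Algebras

variable {R : Type uR} [CommRing R] (I : Ideal R)
variable {A : Type uA} [CommRing A] [Algebra R A]
variable {B : Type uB} [CommRing B] [Algebra R B]

/-- `B` is `I`-almost finitely generated and `I`-almost projective as an `A`-module via
`f : A → B`. -/
def IsAlmostFinitelyGeneratedProjective (f : A →ₐ[R] B) : Prop :=
  letI := f.toRingHom.toAlgebra
  IsAlmostFinitelyGenerated I A B ∧ IsAlmostProjective I A B

/-- `f : A → B` is `I`-almost unramified: `B` is `I`-almost projective as a `B ⊗_A B`-module via
the multiplication map `B ⊗_A B → B`. -/
def IsAlmostUnramified (f : A →ₐ[R] B) : Prop :=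
  letI := f.toRingHom.toAlgebra
  haveI : IsScalarTower R A B := .of_algebraMap_eq fun r ↦ (f.commutes r).symm
  letI : Module (B ⊗[A] B) B := Module.compHom B (Algebra.TensorProduct.lmul' A (S := B)).toRingHom
  IsAlmostProjective I (B ⊗[A] B) B

/-- `f : A → B` is `I`-almost étale: it is `I`-almost flat and `I`-almost unramified. -/
def IsAlmostEtale (f : A →ₐ[R] B) : Prop :=
  letI := f.toRingHom.toAlgebra
  IsAlmostFlat I A B ∧ IsAlmostUnramified I f

/-- `f : A → B` is `I`-almost finite étale: it is `I`-almost étale and `B` is an `I`-almost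
finitely presented `A`-module. -/
def IsAlmostFiniteEtale (f : A →ₐ[R] B) : Prop :=
  letI := f.toRingHom.toAlgebra
  IsAlmostEtale I f ∧ IsAlmostFinitelyPresented I A B

end Algebras

/-! ### Preuniform pairs and the condition `(*)` -/

/-- `b : B` is almost integral over `A`: the `A`-module spanned by all powers of `b` is contained
in a finitely generated `A`-submodule of `B`. -/
def IsAlmostIntegralElement (A : Type uA) [CommRing A] {B : Type uB} [CommRing B] [Algebra A B]
    (b : B) : Prop :=
  ∃ N : Submodule A B, N.FG ∧ Submodule.span A (Set.range fun n : ℕ ↦ b ^ n) ≤ N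

/-- The pair `(A₀, I₀)` is preuniform: `I₀` is generated by a nonzerodivisor `t`, and
`t ^ c (A₀)⁺ ⊆ A₀` for some `c > 0`, where `(A₀)⁺` is the integral closure of `A₀` in
`A₀[1/t]`. -/
def IsPreuniform {A₀ : Type uA} [CommRing A₀] (I₀ : Ideal A₀) : Prop :=
  ∃ t ∈ nonZeroDivisors A₀, I₀ = Ideal.span {t} ∧ ∃ c : ℕ, 0 < c ∧
    ∀ x : Localization.Away t, IsIntegral A₀ x →
      ∃ a : A₀, algebraMap A₀ (Localization.Away t) a =
        algebraMap A₀ (Localization.Away t) t ^ c * x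

/-- The condition `(*)` for a homomorphism of pairs `f : (A₀, I₀) → (B₀, J₀)`. -/
def SatisfiesStar {A₀ : Type uA} [CommRing A₀] {B₀ : Type uB} [CommRing B₀] (f : A₀ →+* B₀)
    (I₀ : Ideal A₀) (J₀ : Ideal B₀) : Prop :=
  letI := f.toAlgebra
  ∃ t : A₀, I₀ = Ideal.span {t} ∧ J₀ = Ideal.span {f t} ∧
    IsPreuniform I₀ ∧
    ((Localization.awayMap f t).Finite ∧ (Localization.awayMap f t).Etale) ∧
    (∀ b : B₀, f t * b = 0 → b = 0) ∧
    ∀ b : B₀, IsAlmostIntegralElement A₀ (algebraMap B₀ (Localization.Away (f t)) b)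

/-! ### The map induced on completions -/

section Completion

variable {R : Type uR} [CommRing R]
variable {A₀ : Type uA} [CommRing A₀] [Algebra R A₀]
variable {B₀ : Type uB} [CommRing B₀] [Algebra R B₀]

theorem span_pow_le_comap (f : A₀ →ₐ[R] B₀) (t : A₀) (n : ℕ) :
    Ideal.span {t} ^ n ≤ (Ideal.span {f t} ^ n).comap f := by
  rw [Ideal.span_singleton_pow, Ideal.span_singleton_pow, Ideal.span_singleton_le_iff_mem,
    Ideal.mem_comap, map_pow]
  exact Ideal.mem_span_singleton_self _

/-- The homomorphism `lim A₀ / t ^ n → lim B₀ / t ^ n` of `t`-adic completions induced by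
`f : A₀ → B₀`. -/
noncomputable def completionMap (f : A₀ →ₐ[R] B₀) (t : A₀) :
    AdicCompletion (Ideal.span {t}) A₀ →ₐ[R] AdicCompletion (Ideal.span {f t}) B₀ :=
  AdicCompletion.liftAlgHom (Ideal.span {f t})
    (fun n ↦ (Ideal.quotientMapₐ (Ideal.span {f t} ^ n) f (span_pow_le_comap f t n)).comp
      ((AdicCompletion.evalₐ (Ideal.span {t}) n).restrictScalars R))
    (fun {m n} hle ↦ by
      ext x
      obtain ⟨x, rfl⟩ := AdicCompletion.mk_surjective _ _ x
      simp only [AlgHom.comp_apply, AlgHom.restrictScalars_apply, AdicCompletion.evalₐ_mk]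
      change Ideal.Quotient.mk _ (f _) = Ideal.Quotient.mk _ (f _)
      rw [Ideal.Quotient.eq, ← map_sub]
      refine span_pow_le_comap f t m ?_
      rw [← Ideal.Quotient.eq]
      exact AdicCompletion.Ideal.mk_eq_mk _ hle x)

end Completion

end AlmostPurity

/-!
For an `A`-algebra `B`, let `P ⊆ A` be the ideal of those `a` for which multiplication by `a` on
`B` factors through a finite free `A`-module, and let `D ⊆ B` be the Noether different, the set of
all `μ(e)` with `e ∈ B ⊗ B` and `(b ⊗ 1)e = (1 ⊗ b)e` for every `b`, where `μ` is the
multiplication. Because `I = I²`, being almost finitely generated projective amounts to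
`I ⊆ P`, and being almost finite étale to `I ⊆ P` and `I ⊆ D`.

Condition `(∗)` puts a power of `t` into `P` and into `D`. Over `A₀[1/t]` the trace form and the
separability idempotent express the identity of `B₀[1/t]` as a finite rank map, and preuniformity
bounds the denominators of the traces of the elements of `B₀`, as these are almost integral.

Now let `P'` and `D'` be the ideals of the `t`-adic completion. An endomorphism of finite rank
modulo `t^k` that agrees with `a` can be corrected by one that is divisible by `t^k ∈ P`, so `P'`
contracts to `P`. Similarly, if `μ(e) = t^n` then an element of `D'` coming from `c ∈ A₀` shows
that `c e` is divisible by `t^n` in the completed tensor square; by pairing with functionals this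
divisibility descends to `B₀ ⊗ B₀` up to multiplication by `P`, and the quotient witnesses
`P·P·c ⊆ D`. This loses nothing because `I = I³`.
-/

namespace AlmostPurity

section FiniteRank

variable {A L M N P : Type*} [CommRing A] [AddCommGroup L] [Module A L] [AddCommGroup M]
  [Module A M] [AddCommGroup N] [Module A N] [AddCommGroup P] [Module A P]

theorem comp_mem_range_dualTensorHom (g : N →ₗ[A] P) {T : M →ₗ[A] N}
    (hT : T ∈ LinearMap.range (dualTensorHom A M N)) (f : L →ₗ[A] M) :
    g ∘ₗ T ∘ₗ f ∈ LinearMap.range (dualTensorHom A L P) := by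
  obtain ⟨z, rfl⟩ := hT
  have hf := LinearMap.congr_fun (dualTensorHom_comp_rTensor_dualMap (P := N) f) z
  have hg := LinearMap.congr_fun (dualTensorHom_comp_lTensor (M := L) g) (f.dualMap.rTensor _ z)
  exact ⟨_, hg.trans (congrArg (g ∘ₗ ·) hf)⟩

theorem mem_range_dualTensorHom_iff_exists_comp {T : M →ₗ[A] N} :
    T ∈ LinearMap.range (dualTensorHom A M N) ↔
      ∃ (n : ℕ) (u : M →ₗ[A] Fin n → A) (v : (Fin n → A) →ₗ[A] N), v ∘ₗ u = T := by
  constructor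
  · rintro ⟨z, rfl⟩
    obtain ⟨n, φ, x, rfl⟩ := TensorProduct.exists_sum_tmul_eq z
    refine ⟨n, LinearMap.pi φ, Fintype.linearCombination A x, ?_⟩
    ext m
    simp [Fintype.linearCombination_apply]
  · rintro ⟨n, u, v, rfl⟩
    exact comp_mem_range_dualTensorHom v (dualTensorHom_bijective.2 LinearMap.id) u

end FiniteRank

section FiniteProjectivityIdeal

section Definition

variable (A : Type*) [CommRing A] (M : Type*) [AddCommGroup M] [Module A M]

/-- The ideal of all `a : A` such that multiplication by `a` on the `A`-module `M` has finite rank,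
that is, is of the form `m ↦ ∑ i, φ i m • x i` with linear forms `φ i`. It measures how far `M` is
from being finite projective. -/
noncomputable def finiteProjectivityIdeal : Ideal A :=
  (LinearMap.range (dualTensorHom A M M)).comap (LinearMap.toSpanSingleton A (M →ₗ[A] M) .id)

end Definition

variable {A : Type*} [CommRing A] {M : Type*} [AddCommGroup M] [Module A M] {a : A}

theorem mem_finiteProjectivityIdeal :
    a ∈ finiteProjectivityIdeal A M ↔ a • LinearMap.id ∈ LinearMap.range (dualTensorHom A M M) :=
  Iff.rfl

theorem mem_finiteProjectivityIdeal_iff_exists_comp :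
    a ∈ finiteProjectivityIdeal A M ↔
      ∃ (n : ℕ) (u : M →ₗ[A] Fin n → A) (v : (Fin n → A) →ₗ[A] M), ∀ m, v (u m) = a • m := by
  simp only [mem_finiteProjectivityIdeal, mem_range_dualTensorHom_iff_exists_comp,
    LinearMap.ext_iff, LinearMap.comp_apply, LinearMap.smul_apply, LinearMap.id_apply]

theorem mem_finiteProjectivityIdeal_of_sum {ι : Type*} [Fintype ι] (φ : ι → Module.Dual A M)
    (x : ι → M) (h : ∀ m, ∑ i, φ i m • x i = a • m) : a ∈ finiteProjectivityIdeal A M :=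
  mem_finiteProjectivityIdeal.mpr ⟨∑ i, φ i ⊗ₜ x i, by ext m; simpa using h m⟩

theorem mem_finiteProjectivityIdeal_iff_exists_sum :
    a ∈ finiteProjectivityIdeal A M ↔
      ∃ (n : ℕ) (φ : Fin n → Module.Dual A M) (x : Fin n → M), ∀ m, ∑ i, φ i m • x i = a • m := by
  refine ⟨fun ⟨z, hz⟩ ↦ ?_, fun ⟨n, φ, x, h⟩ ↦ mem_finiteProjectivityIdeal_of_sum φ x h⟩
  obtain ⟨n, φ, x, rfl⟩ := TensorProduct.exists_sum_tmul_eq z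
  exact ⟨n, φ, x, fun m ↦ by simpa using LinearMap.congr_fun hz m⟩

theorem smul_eq_zero_of_lTensor_eq_zero (ha : a ∈ finiteProjectivityIdeal A M) {X Y : Type*}
    [AddCommGroup X] [Module A X] [AddCommGroup Y] [Module A Y] {i : X →ₗ[A] Y}
    (hi : Function.Injective i) {z : M ⊗[A] X} (hz : i.lTensor M z = 0) : a • z = 0 := by
  obtain ⟨n, u, v, huv⟩ := mem_finiteProjectivityIdeal_iff_exists_comp.mp ha
  have hu : u.rTensor X z = 0 := Module.Flat.lTensor_preserves_injective_linearMap i hi <| by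
    rw [map_zero, ← LinearMap.comp_apply, LinearMap.lTensor_comp_rTensor,
      ← LinearMap.rTensor_comp_lTensor, LinearMap.comp_apply, hz, map_zero]
  have hvu : v ∘ₗ u = a • LinearMap.id := LinearMap.ext huv
  calc a • z = (v ∘ₗ u).rTensor X z := by
        rw [hvu, LinearMap.rTensor_smul, LinearMap.rTensor_id, LinearMap.smul_apply,
          LinearMap.id_apply]
    _ = 0 := by rw [LinearMap.rTensor_comp, LinearMap.comp_apply, hu, map_zero]

theorem exists_finitePresentation_of_fg_le {A : Type uA} [CommRing A] {M : Type*} [AddCommGroup M]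
    [Module A M] {J : Ideal A} (hJ : J.FG) (h : J ≤ finiteProjectivityIdeal A M) :
    ∃ (N : Type uA) (_ : AddCommGroup N) (_ : Module A N) (φ : N →ₗ[A] M),
      Module.FinitePresentation A N ∧ J ≤ (LinearMap.ker φ).annihilator ∧
      J ≤ (LinearMap.range φ).colon Set.univ := by
  obtain ⟨r, s, rfl⟩ := Submodule.fg_iff_exists_fin_generating_family.mp hJ
  choose n u v huv using fun i ↦
    mem_finiteProjectivityIdeal_iff_exists_comp.mp (h (Submodule.subset_span ⟨i, rfl⟩))
  let F := (i : Fin r) → Fin (n i) → A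
  let w : F →ₗ[A] M := LinearMap.lsum A _ A v
  let u' (i : Fin r) : M →ₗ[A] F := LinearMap.single A _ i ∘ₗ u i
  have hwu (i : Fin r) (m : M) : w (u' i m) = s i • m :=
    (LinearMap.lsum_piSingle ..).trans (huv i m)
  let K : Submodule A F := ⨆ i, LinearMap.range (s i • LinearMap.id - u' i ∘ₗ w)
  have hK : K.FG := Submodule.fg_iSup _ fun i ↦ Submodule.fg_range _
  have hKw : K ≤ LinearMap.ker w := by
    refine iSup_le fun i ↦ ?_
    rintro _ ⟨x, rfl⟩
    simp [hwu]
  refine ⟨F ⧸ K, inferInstance, inferInstance, K.liftQ w hKw, ?_, ?_, ?_⟩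
  · exact Module.finitePresentation_of_surjective K.mkQ K.mkQ_surjective (by rwa [K.ker_mkQ])
  · refine Submodule.span_le.mpr ?_
    rintro _ ⟨i, rfl⟩
    refine Submodule.mem_annihilator.mpr fun x hx ↦ ?_
    obtain ⟨y, rfl⟩ := K.mkQ_surjective x
    have hy : w y = 0 := hx
    refine (K.mkQ.map_smul _ _).symm.trans ((Submodule.Quotient.mk_eq_zero K).mpr ?_)
    exact Submodule.mem_iSup_of_mem i ⟨y, by simp [hy]⟩
  · refine Submodule.span_le.mpr ?_
    rintro _ ⟨i, rfl⟩
    exact Submodule.mem_colon.mpr fun m _ ↦ ⟨K.mkQ (u' i m), hwu i m⟩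

end FiniteProjectivityIdeal

section AlmostModules

variable {R : Type uR} [CommRing R] {I : Ideal R}

theorem le_of_forall_mul_mem (hI : IsIdempotentElem I) {K : Ideal R}
    (h : ∀ a ∈ I, ∀ b ∈ I, a * b ∈ K) : I ≤ K :=
  hI.symm.le.trans (Ideal.mul_le.mpr h)

theorem le_of_forall_mul_mul_mem (hI : IsIdempotentElem I) {K : Ideal R}
    (h : ∀ a ∈ I, ∀ b ∈ I, ∀ c ∈ I, a * (b * c) ∈ K) : I ≤ K := by
  refine le_of_forall_mul_mem hI fun a ha b hb ↦ ?_
  have hIK : I ≤ K.colon {a} := le_of_forall_mul_mem hI fun b hb c hc ↦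
    Submodule.mem_colon_singleton.mpr (by simpa [mul_comm] using h a ha b hb c hc)
  simpa [mul_comm] using Submodule.mem_colon_singleton.mp (hIK hb)

variable {A : Type uA} [CommRing A] [Algebra R A] {M : Type uM} [AddCommGroup M] [Module A M]

theorem IsAlmostFinitelyGenerated.exists_fin_generating (h : IsAlmostFinitelyGenerated I A M)
    {ε : R} (hε : ε ∈ I) : ∃ (n : ℕ) (p : (Fin n → A) →ₗ[A] M),
      ∀ m, algebraMap R A ε • m ∈ LinearMap.range p := by
  obtain ⟨N, hN, hεN⟩ := h (Ideal.span {ε}) (Submodule.fg_span_singleton ε) (by simpa)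
  obtain ⟨n, p, rfl⟩ := N.fg_iff_exists_fin_linearMap.mp hN
  exact ⟨n, p, hεN ε (Ideal.mem_span_singleton_self ε)⟩

theorem IsAlmostFinitelyPresented.isAlmostFinitelyGenerated
    (h : IsAlmostFinitelyPresented I A M) : IsAlmostFinitelyGenerated I A M := by
  intro I₀ hI₀ hle
  obtain ⟨N, _, _, φ, _, -, hφ⟩ := h I₀ hI₀ hle
  exact ⟨LinearMap.range φ, Submodule.fg_range φ, hφ⟩

theorem IsAlmostProjective.exists_lift (h : IsAlmostProjective I A M) {X : Type uA} {Y : Type uM}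
    [AddCommGroup X] [Module A X] [AddCommGroup Y] [Module A Y] {p : X →ₗ[A] Y}
    (hp : Function.Surjective p) (g : M →ₗ[A] Y) {ε : R} (hε : ε ∈ I) :
    ∃ l : M →ₗ[A] X, ∀ m, p (l m) = algebraMap R A ε • g m := by
  obtain ⟨l, hl⟩ := h (ULift.{uM} X) (ULift.{uA} Y)
    (ULift.moduleEquiv.symm.toLinearMap ∘ₗ p ∘ₗ ULift.moduleEquiv.toLinearMap)
    (ULift.moduleEquiv.symm.surjective.comp (hp.comp ULift.moduleEquiv.surjective))
    (ULift.moduleEquiv.symm.toLinearMap ∘ₗ g) ε hε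
  exact ⟨ULift.moduleEquiv.toLinearMap ∘ₗ l, fun m ↦ congrArg ULift.down (LinearMap.congr_fun hl m)⟩

theorem IsAlmostProjective.le_comap_finiteProjectivityIdeal (hI : IsIdempotentElem I)
    (hproj : IsAlmostProjective I A M) (hfg : IsAlmostFinitelyGenerated I A M) :
    I ≤ (finiteProjectivityIdeal A M).comap (algebraMap R A) := by
  refine le_of_forall_mul_mem hI fun ε hε δ hδ ↦ ?_
  obtain ⟨n, p, hp⟩ := hfg.exists_fin_generating hδ
  obtain ⟨l, hl⟩ := hproj.exists_lift p.surjective_rangeRestrict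
    ((algebraMap R A δ • LinearMap.id).codRestrict _ hp) hε
  refine mem_finiteProjectivityIdeal_iff_exists_comp.mpr ⟨n, l, p, fun m ↦ ?_⟩
  rw [map_mul, mul_smul]
  exact congrArg Subtype.val (hl m)

theorem isAlmostProjective_of_le_comap
    (h : I ≤ (finiteProjectivityIdeal A M).comap (algebraMap R A)) : IsAlmostProjective I A M := by
  intro X Y _ _ _ _ p hp g ε hε
  obtain ⟨n, u, v, huv⟩ := mem_finiteProjectivityIdeal_iff_exists_comp.mp (h hε)
  obtain ⟨w, hw⟩ := Module.projective_lifting_property p (g ∘ₗ v) hp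
  refine ⟨w ∘ₗ u, ?_⟩
  ext m
  rw [← LinearMap.comp_assoc, hw, LinearMap.comp_apply, LinearMap.comp_apply, huv, map_smul,
    LinearMap.smul_apply]

theorem isAlmostFinitelyPresented_of_le_comap
    (h : I ≤ (finiteProjectivityIdeal A M).comap (algebraMap R A)) :
    IsAlmostFinitelyPresented I A M := by
  intro I₀ hI₀ hle
  obtain ⟨N, _, _, φ, hN, hker, hrange⟩ := exists_finitePresentation_of_fg_le
    (hI₀.map (algebraMap R A)) (Ideal.map_le_iff_le_comap.mpr (hle.trans h))
  exact ⟨N, _, _, φ, hN,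
    fun ε hε ↦ Submodule.mem_annihilator.mp (hker (Ideal.mem_map_of_mem _ hε)),
    fun ε hε m ↦ Submodule.mem_colon.mp (hrange (Ideal.mem_map_of_mem _ hε)) m trivial⟩

theorem isAlmostFlat_of_le_comap (h : I ≤ (finiteProjectivityIdeal A M).comap (algebraMap R A)) :
    IsAlmostFlat I A M :=
  fun _ _ _ _ _ _ _ hi _ hz _ hε ↦ smul_eq_zero_of_lTensor_eq_zero (h hε) hi hz

theorem IsAlmostFlat.smul_eq_zero (h : IsAlmostFlat I A M) {X Y : Type uA} [AddCommGroup X]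
    [Module A X] [AddCommGroup Y] [Module A Y] {i : X →ₗ[A] Y} (hi : Function.Injective i)
    {z : M ⊗[A] X} (hz : i.lTensor M z = 0) {ε : R} (hε : ε ∈ I) : algebraMap R A ε • z = 0 := by
  let eX : X ≃ₗ[A] ULift.{uM} X := ULift.moduleEquiv.symm
  let eY : Y ≃ₗ[A] ULift.{uM} Y := ULift.moduleEquiv.symm
  let i' : ULift.{uM} X →ₗ[A] ULift.{uM} Y := eY.toLinearMap ∘ₗ i ∘ₗ eX.symm.toLinearMap
  have hi' : i' ∘ₗ eX.toLinearMap = eY.toLinearMap ∘ₗ i := by ext; simp [i']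
  refine (eX.lTensor M).injective ?_
  rw [map_zero, map_smul]
  refine h _ _ i' (eY.injective.comp (hi.comp eX.symm.injective)) _ ?_ ε hε
  change i'.lTensor M (eX.toLinearMap.lTensor M z) = 0
  rw [← LinearMap.lTensor_comp_apply, hi', LinearMap.lTensor_comp_apply, hz, map_zero]

theorem IsAlmostFlat.smul_mem_range_lTensor (h : IsAlmostFlat I A M) {X Y Z : Type uA}
    [AddCommGroup X] [Module A X] [AddCommGroup Y] [Module A Y] [AddCommGroup Z] [Module A Z]
    {f : X →ₗ[A] Y} {g : Y →ₗ[A] Z} (hfg : Function.Exact f g) {z : M ⊗[A] Y}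
    (hz : g.lTensor M z = 0) {ε : R} (hε : ε ∈ I) :
    algebraMap R A ε • z ∈ LinearMap.range (f.lTensor M) := by
  let K := LinearMap.ker g
  have hK : Function.Exact f K.mkQ := by
    rw [LinearMap.exact_iff, Submodule.ker_mkQ, ← hfg.linearMap_ker_eq]
  rw [← LinearMap.exact_iff.mp (lTensor_exact M hK K.mkQ_surjective),
    LinearMap.mem_ker, map_smul]
  refine h.smul_eq_zero (LinearMap.ker_eq_bot.mp (K.ker_liftQ_eq_bot' g rfl)) ?_ hε
  rw [← LinearMap.comp_apply, ← LinearMap.lTensor_comp, Submodule.liftQ_mkQ, hz]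

/-- Almost flatness preserves the kernel of `Dual A (A ^ n) → Dual A (A ^ m)` for a presentation
`A ^ m → A ^ n → N`, so `N →ₗ[A] M` is almost `Dual A N ⊗[A] M`. -/
theorem IsAlmostFlat.smul_mem_range_dualTensorHom (h : IsAlmostFlat I A M) {N : Type uA}
    [AddCommGroup N] [Module A N] [Module.FinitePresentation A N] (φ : N →ₗ[A] M) {ε : R}
    (hε : ε ∈ I) : algebraMap R A ε • φ ∈ LinearMap.range (dualTensorHom A N M) := by
  obtain ⟨n, m, π, r, hπ, hr⟩ := Module.FinitePresentation.exists_fin' A N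
  obtain ⟨z, hz⟩ := (dualTensorHom_bijective (R := A)).2 (φ ∘ₗ π)
  have hrz : r.dualMap.rTensor M z = 0 := (dualTensorHom_bijective (R := A)).1 <| by
    rw [map_zero]
    refine (LinearMap.congr_fun (dualTensorHom_comp_rTensor_dualMap (P := M) r) z).trans ?_
    rw [LinearMap.comp_apply, hz, LinearMap.lcomp_apply', LinearMap.comp_assoc,
      hr.linearMap_comp_eq_zero, LinearMap.comp_zero]
  have hπr : Function.Exact π.dualMap r.dualMap :=
    LinearMap.exact_lcomp_of_exact_of_surjective A hr hπ
  obtain ⟨w, hw⟩ := h.smul_mem_range_lTensor (z := TensorProduct.comm A _ _ z) hπr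
    (by rw [LinearMap.lTensor_comm, hrz, map_zero]) hε
  obtain ⟨w, rfl⟩ := (TensorProduct.comm A (Module.Dual A N) M).surjective w
  have hw' : π.dualMap.rTensor M w = algebraMap R A ε • z :=
    (TensorProduct.comm A _ _).injective (by rw [← LinearMap.lTensor_comm, hw, map_smul])
  refine ⟨w, LinearMap.cancel_right hπ |>.mp ?_⟩
  calc dualTensorHom A N M w ∘ₗ π = dualTensorHom A _ M (π.dualMap.rTensor M w) :=
        (LinearMap.congr_fun (dualTensorHom_comp_rTensor_dualMap π) w).symm
    _ = (algebraMap R A ε • φ) ∘ₗ π := by rw [hw', map_smul, hz, LinearMap.smul_comp]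

theorem exists_linearMap_comp_eq_mul_smul {A M N : Type*} [CommRing A] [AddCommGroup M]
    [Module A M] [AddCommGroup N] [Module A N] (φ : N →ₗ[A] M) {a b : A}
    (ha : ∀ x, φ x = 0 → a • x = 0) (hb : ∀ m, b • m ∈ LinearMap.range φ) :
    ∃ ψ : M →ₗ[A] N, ∀ m, φ (ψ m) = (a * b) • m := by
  choose s hs using hb
  have key (x y : N) (h : φ x = φ y) : a • x = a • y := by
    rw [← sub_eq_zero, ← smul_sub]
    exact ha _ (by rw [map_sub, h, sub_self])
  refine ⟨{ toFun m := a • s m, map_add' x y := ?_, map_smul' c x := ?_ }, fun m ↦ ?_⟩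
  · rw [← smul_add]
    exact key _ _ (by rw [map_add, hs, hs, hs, smul_add])
  · rw [RingHom.id_apply, smul_comm c]
    exact key _ _ (by rw [map_smul, hs, hs, smul_comm])
  · exact (map_smul φ a (s m)).trans (by rw [hs, smul_smul])

theorem IsAlmostFlat.le_comap_finiteProjectivityIdeal (hI : IsIdempotentElem I)
    (hflat : IsAlmostFlat I A M) (hfp : IsAlmostFinitelyPresented I A M) :
    I ≤ (finiteProjectivityIdeal A M).comap (algebraMap R A) := by
  refine le_of_forall_mul_mul_mem hI fun ε hε δ hδ η hη ↦ ?_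
  have hI₀ : Ideal.span {δ, η} ≤ I := Ideal.span_le.mpr (Set.pair_subset hδ hη)
  obtain ⟨N, _, _, φ, _, hker, hrange⟩ :=
    hfp (Ideal.span {δ, η}) (Submodule.fg_span (Set.toFinite _)) hI₀
  obtain ⟨ψ, hψ⟩ := exists_linearMap_comp_eq_mul_smul φ
    (hker δ (Ideal.subset_span (by simp))) (hrange η (Ideal.subset_span (by simp)))
  have hφψ : (algebraMap R A ε • φ) ∘ₗ ψ = algebraMap R A (ε * (δ * η)) • LinearMap.id := by
    ext m
    simp only [LinearMap.comp_apply, LinearMap.smul_apply, hψ, LinearMap.id_apply, smul_smul,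
      map_mul]
  rw [Ideal.mem_comap, mem_finiteProjectivityIdeal, ← hφψ]
  exact comp_mem_range_dualTensorHom .id (hflat.smul_mem_range_dualTensorHom φ hε) ψ

theorem isAlmostFinitelyGenerated_and_isAlmostProjective_iff (hI : IsIdempotentElem I) :
    IsAlmostFinitelyGenerated I A M ∧ IsAlmostProjective I A M ↔
      I ≤ (finiteProjectivityIdeal A M).comap (algebraMap R A) :=
  ⟨fun h ↦ h.2.le_comap_finiteProjectivityIdeal hI h.1, fun h ↦
    ⟨(isAlmostFinitelyPresented_of_le_comap h).isAlmostFinitelyGenerated,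
      isAlmostProjective_of_le_comap h⟩⟩

theorem isAlmostFlat_and_isAlmostFinitelyPresented_iff (hI : IsIdempotentElem I) :
    IsAlmostFlat I A M ∧ IsAlmostFinitelyPresented I A M ↔
      I ≤ (finiteProjectivityIdeal A M).comap (algebraMap R A) :=
  ⟨fun h ↦ h.1.le_comap_finiteProjectivityIdeal hI h.2, fun h ↦
    ⟨isAlmostFlat_of_le_comap h, isAlmostFinitelyPresented_of_le_comap h⟩⟩

end AlmostModules

section NoetherDifferent

/-- The Noether different of an `A`-algebra `B`: the image in `B` of the annihilator of the kernel
of the multiplication `B ⊗[A] B → B`. It measures how far `B` is from being unramified over `A`. -/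
noncomputable def noetherDifferent (A B : Type*) [CommRing A] [CommRing B] [Algebra A B] :
    Ideal B :=
  (KaehlerDifferential.ideal A B).annihilator.map (Algebra.TensorProduct.lmul' A (S := B))

theorem mem_noetherDifferent_iff {A B : Type*} [CommRing A] [CommRing B] [Algebra A B] {c : B} :
    c ∈ noetherDifferent A B ↔ ∃ e : B ⊗[A] B, (∀ b, (b ⊗ₜ 1) * e = (1 ⊗ₜ b) * e) ∧
      Algebra.TensorProduct.lmul' A e = c := by
  have hann (e : B ⊗[A] B) :
      e ∈ (KaehlerDifferential.ideal A B).annihilator ↔ ∀ b, (b ⊗ₜ 1) * e = (1 ⊗ₜ b) * e := by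
    rw [← KaehlerDifferential.span_range_eq_ideal, Submodule.mem_annihilator_span]
    simp only [Subtype.forall, Set.forall_mem_range, smul_eq_mul, mul_comm e, sub_mul, sub_eq_zero]
    exact forall_congr' fun b ↦ eq_comm
  simp only [noetherDifferent, Ideal.mem_map_iff_of_surjective _
    (fun b ↦ ⟨b ⊗ₜ 1, by simp⟩ : Function.Surjective (Algebra.TensorProduct.lmul' A (S := B))),
    hann]

theorem isAlmostProjective_iff_of_surjective {R : Type uR} [CommRing R] {I : Ideal R}
    {S : Type uA} [CommRing S] [Algebra R S] {B : Type uB} [CommRing B] [Algebra S B]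
    (hSB : Function.Surjective (algebraMap S B)) :
    IsAlmostProjective I S B ↔ ∀ ε ∈ I, algebraMap S B (algebraMap R S ε) ∈
      (RingHom.ker (algebraMap S B)).annihilator.map (algebraMap S B) := by
  simp only [Ideal.mem_map_iff_of_surjective _ hSB, Submodule.mem_annihilator]
  constructor
  · intro h ε hε
    obtain ⟨l, hl⟩ := h.exists_lift (p := Algebra.linearMap S B) hSB .id hε
    refine ⟨l 1, fun x hx ↦ ?_, (hl 1).trans (Algebra.algebraMap_eq_smul_one _).symm⟩
    rw [smul_eq_mul, mul_comm, ← smul_eq_mul, ← map_smul, ← Algebra.algebraMap_eq_smul_one, hx,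
      map_zero]
  · intro h X Y _ _ _ _ p hp g ε hε
    obtain ⟨e, he, heε⟩ := h ε hε
    obtain ⟨x, hx⟩ := hp (g 1)
    obtain ⟨ψ, hψ⟩ := exists_linearMap_comp_eq_mul_smul (Algebra.linearMap S B) (a := e) (b := 1)
      he (fun m ↦ by simpa using hSB m)
    refine ⟨LinearMap.toSpanSingleton S X x ∘ₗ ψ, LinearMap.ext fun b ↦ ?_⟩
    calc p (ψ b • x) = g (Algebra.linearMap S B (ψ b)) := by
          rw [map_smul, hx, ← map_smul, ← Algebra.algebraMap_eq_smul_one, Algebra.linearMap_apply]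
      _ = algebraMap R S ε • g b := by
          rw [hψ, mul_one, Algebra.smul_def, heε, ← Algebra.smul_def, map_smul]

end NoetherDifferent

section AlmostEtale

variable {R : Type uR} [CommRing R] {I : Ideal R} {A : Type uA} [CommRing A] [Algebra R A]
  {B : Type uB} [CommRing B] [Algebra R B] (f : A →ₐ[R] B)

theorem isAlmostFinitelyGeneratedProjective_iff (hI : IsIdempotentElem I) :
    IsAlmostFinitelyGeneratedProjective I f ↔
      letI := f.toRingHom.toAlgebra
      I ≤ (finiteProjectivityIdeal A B).comap (algebraMap R A) :=
  letI := f.toRingHom.toAlgebra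
  isAlmostFinitelyGenerated_and_isAlmostProjective_iff hI

theorem isAlmostUnramified_iff :
    IsAlmostUnramified I f ↔
      letI := f.toRingHom.toAlgebra
      I ≤ (noetherDifferent A B).comap (algebraMap R B) := by
  let := f.toRingHom.toAlgebra
  have : IsScalarTower R A B := .of_algebraMap_eq fun r ↦ (f.commutes r).symm
  let μ := Algebra.TensorProduct.lmul' A (S := B)
  let := μ.toRingHom.toAlgebra
  have hμ : Function.Surjective (algebraMap (B ⊗[A] B) B) := fun b ↦ ⟨b ⊗ₜ 1, mul_one b⟩
  have hR (ε : R) : algebraMap (B ⊗[A] B) B (algebraMap R (B ⊗[A] B) ε) = algebraMap R B ε :=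
    mul_one _
  refine (isAlmostProjective_iff_of_surjective hμ).trans ?_
  simp only [hR]
  rfl

theorem isAlmostFiniteEtale_iff (hI : IsIdempotentElem I) :
    IsAlmostFiniteEtale I f ↔
      letI := f.toRingHom.toAlgebra
      I ≤ (finiteProjectivityIdeal A B).comap (algebraMap R A) ∧
        I ≤ (noetherDifferent A B).comap (algebraMap R B) := by
  let := f.toRingHom.toAlgebra
  rw [← isAlmostFlat_and_isAlmostFinitelyPresented_iff hI, ← isAlmostUnramified_iff f]
  exact and_right_comm

end AlmostEtale

section AdicCompletions

variable {A N N' P : Type*} [CommRing A] [AddCommGroup N] [Module A N] [AddCommGroup N']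
  [Module A N'] [AddCommGroup P] [Module A P] {t : A}

theorem mem_span_singleton_pow_smul_top {n : ℕ} {x : N} :
    x ∈ (Ideal.span {t} ^ n • ⊤ : Submodule A N) ↔ ∃ y, x = t ^ n • y := by
  rw [Ideal.span_singleton_pow, Submodule.ideal_span_singleton_smul,
    Submodule.mem_smul_pointwise_iff_exists]
  simp only [Submodule.mem_top, true_and, eq_comm]

theorem eq_zero_of_forall_exists_eq_pow_smul [IsHausdorff (Ideal.span {t}) N] {x : N}
    (h : ∀ n : ℕ, ∃ y, x = t ^ n • y) : x = 0 :=
  IsHausdorff.haus ‹_› x fun n ↦ SModEq.zero.mpr (mem_span_singleton_pow_smul_top.mpr (h n))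

theorem isHausdorff_quotient_pow_smul_top (n : ℕ) :
    IsHausdorff (Ideal.span {t}) (P ⧸ (Ideal.span {t} ^ n • ⊤ : Submodule A P)) where
  haus' x hx := by
    obtain ⟨y, rfl⟩ := mem_span_singleton_pow_smul_top.mp (SModEq.zero.mp (hx n))
    obtain ⟨z, rfl⟩ := Submodule.mkQ_surjective _ y
    exact (Submodule.Quotient.mk_eq_zero _).mpr (mem_span_singleton_pow_smul_top.mpr ⟨z, rfl⟩)

theorem exists_linearMap_smul_eq {a : A} (ha : IsSMulRegular P a) {g : N →ₗ[A] P}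
    (hg : ∀ x, ∃ y, g x = a • y) : ∃ h : N →ₗ[A] P, ∀ x, g x = a • h x :=
  ⟨g.codRestrictOfInjective (LinearMap.lsmul A P a) ha fun x ↦ (hg x).imp fun _ ↦ Eq.symm,
    fun x ↦ (g.codRestrictOfInjective_comp_apply (LinearMap.lsmul A P a) ha _ x).symm⟩

/-- The linear map `j : N → N'` exhibits `N'` as the `t`-adic completion of the `t`-torsion-free
module `N`. The last two fields say that `j` induces bijections `N / t ^ n N → N' / t ^ n N'`. -/
structure IsTorsionFreeCompletion (t : A) (j : N →ₗ[A] N') : Prop where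
  isSMulRegular : IsSMulRegular N t
  isAdicComplete : IsAdicComplete (Ideal.span {t}) N'
  exists_eq_add (n : ℕ) (x' : N') : ∃ x y', x' = j x + t ^ n • y'
  exists_eq_smul (n : ℕ) (x : N) (y' : N') : j x = t ^ n • y' → ∃ y, x = t ^ n • y

namespace IsTorsionFreeCompletion

variable {j : N →ₗ[A] N'} (hj : IsTorsionFreeCompletion t j)
include hj

theorem isSMulRegular_right : IsSMulRegular N' t := by
  refine (isSMulRegular_iff_right_eq_zero_of_smul).mpr fun x' hx' ↦ ?_
  have := hj.isAdicComplete
  refine eq_zero_of_forall_exists_eq_pow_smul (t := t) fun n ↦ ?_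
  obtain ⟨x, y', rfl⟩ := hj.exists_eq_add n x'
  obtain ⟨z, hz⟩ := hj.exists_eq_smul (n + 1) (t • x) (-y') <| by
    rw [map_smul, smul_neg, pow_succ', mul_smul, eq_neg_iff_add_eq_zero, ← smul_add, hx']
  rw [pow_succ', mul_smul] at hz
  exact ⟨j z + y', by rw [hj.isSMulRegular hz, map_smul, smul_add]⟩

theorem linearMap_ext [IsHausdorff (Ideal.span {t}) P] {f g : N' →ₗ[A] P}
    (h : f ∘ₗ j = g ∘ₗ j) : f = g := by
  ext x'
  refine sub_eq_zero.mp (eq_zero_of_forall_exists_eq_pow_smul (t := t) fun n ↦ ?_)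
  obtain ⟨x, y', rfl⟩ := hj.exists_eq_add n x'
  have hx : f (j x) = g (j x) := LinearMap.congr_fun h x
  exact ⟨f y' - g y', by simp only [map_add, map_smul, hx, smul_sub]; abel⟩

theorem exists_extension_quotient (n : ℕ) (g : N →ₗ[A] P) :
    ∃ r : N' →ₗ[A] P ⧸ (Ideal.span {t} ^ n • ⊤ : Submodule A P), r ∘ₗ j = Submodule.mkQ _ ∘ₗ g := by
  let p := (Ideal.span {t} ^ n • ⊤ : Submodule A N').mkQ ∘ₗ j
  let q := (Ideal.span {t} ^ n • ⊤ : Submodule A P).mkQ ∘ₗ g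
  have hp : Function.Surjective p := fun z ↦ by
    obtain ⟨x', rfl⟩ := Submodule.mkQ_surjective _ z
    obtain ⟨x, y', rfl⟩ := hj.exists_eq_add n x'
    refine ⟨x, (Submodule.Quotient.eq _).mpr (mem_span_singleton_pow_smul_top.mpr ⟨-y', ?_⟩)⟩
    rw [sub_add_cancel_left, smul_neg]
  have hpq : LinearMap.ker p ≤ LinearMap.ker q := fun x hx ↦ by
    obtain ⟨y', hy'⟩ :=
      mem_span_singleton_pow_smul_top.mp ((Submodule.Quotient.mk_eq_zero _).mp hx)
    obtain ⟨y, rfl⟩ := hj.exists_eq_smul n x y' hy'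
    exact (Submodule.Quotient.mk_eq_zero _).mpr
      (mem_span_singleton_pow_smul_top.mpr ⟨g y, map_smul ..⟩)
  let e := p.quotKerEquivOfSurjective hp
  refine ⟨(LinearMap.ker p).liftQ q hpq ∘ₗ e.symm.toLinearMap ∘ₗ Submodule.mkQ _, ?_⟩
  ext x
  exact congrArg ((LinearMap.ker p).liftQ q hpq) (e.symm_apply_apply ((LinearMap.ker p).mkQ x))

theorem exists_extension [IsAdicComplete (Ideal.span {t}) P] (g : N →ₗ[A] P) :
    ∃ g' : N' →ₗ[A] P, g' ∘ₗ j = g := by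
  choose r hr using fun n ↦ hj.exists_extension_quotient n g
  have hrr {m n : ℕ} (hmn : m ≤ n) : Submodule.factorPow (Ideal.span {t}) P hmn ∘ₗ r n = r m := by
    have := isHausdorff_quotient_pow_smul_top (P := P) (t := t) m
    exact hj.linearMap_ext (by rw [LinearMap.comp_assoc, hr, hr]; rfl)
  refine ⟨IsAdicComplete.lift _ r hrr, LinearMap.ext fun x ↦ ?_⟩
  refine IsHausdorff.eq_iff_smodEq (I := Ideal.span {t}) |>.mpr fun n ↦ ?_
  exact (IsAdicComplete.mk_lift _ hrr n (j x)).trans (LinearMap.congr_fun (hr n) x)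

theorem exists_linearMap_eq_add {k : ℕ} (hk : t ^ k ∈ finiteProjectivityIdeal A P) (n : ℕ)
    (g : P →ₗ[A] N') : ∃ (h : P →ₗ[A] N) (y' : P → N'), ∀ x, g x = j (h x) + t ^ n • y' x := by
  obtain ⟨m, φ, e, he⟩ := mem_finiteProjectivityIdeal_iff_exists_sum.mp hk
  choose a y' hay using fun i ↦ hj.exists_eq_add (k + n) (g (e i))
  let h₀ : P →ₗ[A] N := ∑ i, (φ i).smulRight (a i)
  have hh₀ (x : P) : t ^ k • g x = j (h₀ x) + t ^ (k + n) • ∑ i, φ i x • y' i := by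
    rw [← map_smul, ← he]
    simp only [h₀, LinearMap.sum_apply, LinearMap.smulRight_apply, map_sum, map_smul, hay, smul_add,
      Finset.sum_add_distrib, Finset.smul_sum, smul_comm (φ _ x)]
  obtain ⟨h, hh⟩ := exists_linearMap_smul_eq (hj.isSMulRegular.pow k) fun x ↦
    hj.exists_eq_smul k (h₀ x) (g x - t ^ n • ∑ i, φ i x • y' i) <| by
      rw [smul_sub, hh₀, smul_smul, ← pow_add, add_sub_cancel_right]
  refine ⟨h, fun x ↦ ∑ i, φ i x • y' i, fun x ↦ hj.isSMulRegular_right.pow k ?_⟩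
  simp only [hh₀, hh, map_smul, smul_add, smul_smul, pow_add]

end IsTorsionFreeCompletion

end AdicCompletions

section ScalarExtension

variable {A A' M M' : Type*} [CommRing A] [CommRing A'] [Algebra A A'] [AddCommGroup M] [Module A M]
  [AddCommGroup M'] [Module A M'] [Module A' M'] [IsScalarTower A A' M'] {t : A}
  (hA : IsTorsionFreeCompletion t (Algebra.linearMap A A'))

include hA

theorem IsTorsionFreeCompletion.map_smul_of_isHausdorff {N' : Type*} [AddCommGroup N']
    [Module A N'] [Module A' N'] [IsScalarTower A A' N'] [IsHausdorff (Ideal.span {t}) N']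
    (f : M' →ₗ[A] N') (a' : A') (x : M') : f (a' • x) = a' • f x := by
  refine sub_eq_zero.mp (eq_zero_of_forall_exists_eq_pow_smul (t := t) fun n ↦ ?_)
  obtain ⟨a, b', rfl⟩ := hA.exists_eq_add n a'
  refine ⟨f (b' • x) - b' • f x, ?_⟩
  simp only [Algebra.linearMap_apply, add_smul, algebraMap_smul, map_add, map_smul, smul_assoc,
    smul_sub, add_sub_add_left_eq_sub]

variable {j : M →ₗ[A] M'} (hj : IsTorsionFreeCompletion t j)
include hj

theorem IsTorsionFreeCompletion.exists_dual_extension (φ : Module.Dual A M) :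
    ∃ φ' : Module.Dual A' M', ∀ x, φ' (j x) = algebraMap A A' (φ x) := by
  have := hA.isAdicComplete
  obtain ⟨g, hg⟩ := hj.exists_extension (Algebra.linearMap A A' ∘ₗ φ)
  exact ⟨{ g with map_smul' := hA.map_smul_of_isHausdorff g }, LinearMap.congr_fun hg⟩

theorem IsTorsionFreeCompletion.exists_dual_extension_of_sum {ι : Type*} [Fintype ι]
    {φ : ι → Module.Dual A M} {x : ι → M} {a : A} (h : ∀ m, ∑ i, φ i m • x i = a • m) :
    ∃ φ' : ι → Module.Dual A' M', ∀ m', ∑ i, φ' i m' • j (x i) = a • m' := by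
  choose φ' hφ' using fun i ↦ hA.exists_dual_extension hj (φ i)
  have := hj.isAdicComplete
  have hlin : (∑ i, (φ' i).smulRight (j (x i))).restrictScalars A = a • LinearMap.id := by
    refine hj.linearMap_ext (LinearMap.ext fun m ↦ ?_)
    simpa [hφ'] using congrArg j (h m)
  exact ⟨φ', fun m' ↦ by simpa using LinearMap.congr_fun hlin m'⟩

theorem finiteProjectivityIdeal_le_comap :
    finiteProjectivityIdeal A M ≤ (finiteProjectivityIdeal A' M').comap (algebraMap A A') := by
  intro a ha
  obtain ⟨n, φ, x, h⟩ := mem_finiteProjectivityIdeal_iff_exists_sum.mp ha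
  obtain ⟨φ', h'⟩ := hA.exists_dual_extension_of_sum hj h
  exact mem_finiteProjectivityIdeal_of_sum φ' (j ∘ x) fun m' ↦ (h' m').trans
    (algebraMap_smul A' a m').symm

theorem comap_le_finiteProjectivityIdeal {k : ℕ} (hk : t ^ k ∈ finiteProjectivityIdeal A M) :
    (finiteProjectivityIdeal A' M').comap (algebraMap A A') ≤ finiteProjectivityIdeal A M := by
  intro a ha
  obtain ⟨n, φ', x', h⟩ := mem_finiteProjectivityIdeal_iff_exists_sum.mp ha
  choose φ y' hφ using fun i ↦ hA.exists_linearMap_eq_add hk k ((φ' i).restrictScalars A ∘ₗ j)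
  choose x z' hx using fun i ↦ hj.exists_eq_add k (x' i)
  let T : M →ₗ[A] M := dualTensorHom A M M (∑ i, φ i ⊗ₜ x i)
  obtain ⟨δ, hδ⟩ : ∃ δ : M →ₗ[A] M, ∀ m, (a • .id - T : M →ₗ[A] M) m = t ^ k • δ m := by
    refine exists_linearMap_smul_eq (hj.isSMulRegular.pow k) fun m ↦
      hj.exists_eq_smul k _ (∑ i, (y' i m • x' i + φ i m • z' i)) ?_
    have hm : a • j m = ∑ i, φ' i (j m) • x' i := by rw [h, algebraMap_smul]
    have hφ' (i : Fin n) : φ' i (j m) = algebraMap A A' (φ i m) + t ^ k • y' i m := hφ i m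
    simp only [T, LinearMap.sub_apply, LinearMap.smul_apply, LinearMap.id_apply, map_sub, map_smul,
      hm, map_sum, dualTensorHom_apply, LinearMap.sum_apply, ← Finset.sum_sub_distrib,
      Finset.smul_sum, hφ', add_smul, algebraMap_smul, smul_assoc]
    refine Finset.sum_congr rfl fun i _ ↦ ?_
    nth_rw 1 [hx]
    rw [smul_add, smul_add, smul_comm (φ i m)]
    abel
  have hTδ : a • LinearMap.id = T + (t ^ k • LinearMap.id) ∘ₗ δ :=
    LinearMap.ext fun m ↦ by simpa [sub_eq_iff_eq_add'] using hδ m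
  rw [mem_finiteProjectivityIdeal, hTδ]
  exact add_mem ⟨_, rfl⟩ (comp_mem_range_dualTensorHom .id hk δ)

theorem comap_finiteProjectivityIdeal {k : ℕ} (hk : t ^ k ∈ finiteProjectivityIdeal A M) :
    (finiteProjectivityIdeal A' M').comap (algebraMap A A') = finiteProjectivityIdeal A M :=
  (comap_le_finiteProjectivityIdeal hA hj hk).antisymm (finiteProjectivityIdeal_le_comap hA hj)

theorem span_range_eq_top_of_pow_mem {k : ℕ} (hk : t ^ k ∈ finiteProjectivityIdeal A M) :
    Submodule.span A' (Set.range j) = ⊤ := by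
  obtain ⟨n, φ, e, he⟩ := mem_finiteProjectivityIdeal_iff_exists_sum.mp hk
  obtain ⟨φ', he'⟩ := hA.exists_dual_extension_of_sum hj he
  refine eq_top_iff.mpr fun x' _ ↦ ?_
  obtain ⟨x, y', rfl⟩ := hj.exists_eq_add k x'
  rw [← he']
  exact add_mem (Submodule.subset_span ⟨x, rfl⟩) <| Submodule.sum_mem _ fun i _ ↦
    Submodule.smul_mem _ _ (Submodule.subset_span ⟨e i, rfl⟩)

end ScalarExtension

section DifferentCompletion

theorem smul_eq_zero_of_isSMulRegular {A M N : Type*} [CommRing A] [AddCommGroup M] [Module A M]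
    [AddCommGroup N] [Module A N] {a c : A} (ha : a ∈ finiteProjectivityIdeal A M)
    (hc : IsSMulRegular N c) {z : M ⊗[A] N} (hz : c • z = 0) : a • z = 0 :=
  smul_eq_zero_of_lTensor_eq_zero ha (i := LinearMap.lsmul A N c) hc <| by
    rwa [show LinearMap.lsmul A N c = c • LinearMap.id from rfl, LinearMap.lTensor_smul,
      LinearMap.lTensor_id]

theorem sum_tmul_lid_rTensor {A M N ι : Type*} [CommRing A] [AddCommGroup M] [Module A M]
    [AddCommGroup N] [Module A N] [Fintype ι] {φ : ι → Module.Dual A M} {x : ι → M} {a : A}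
    (h : ∀ m, ∑ i, φ i m • x i = a • m) (z : M ⊗[A] N) :
    ∑ i, x i ⊗ₜ TensorProduct.lid A N ((φ i).rTensor N z) = a • z := by
  induction z with
  | zero => simp
  | tmul m n =>
    simp only [LinearMap.rTensor_tmul, TensorProduct.lid_tmul, ← TensorProduct.smul_tmul,
      ← TensorProduct.sum_tmul, h, TensorProduct.smul_tmul']
  | add z w hz hw => simp only [map_add, TensorProduct.tmul_add, Finset.sum_add_distrib, hz, hw,
      smul_add]

theorem mul_eq_smul_of_lmul'_eq_algebraMap {A B : Type*} [CommRing A] [CommRing B] [Algebra A B]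
    {e z : B ⊗[A] B} (he : ∀ b, (b ⊗ₜ 1) * e = (1 ⊗ₜ b) * e) {a : A}
    (hz : Algebra.TensorProduct.lmul' A z = algebraMap A B a) : z * e = a • e := by
  have key : z * e = (1 ⊗ₜ Algebra.TensorProduct.lmul' A z) * e := by
    clear hz
    induction z with
    | zero => simp
    | tmul x y =>
      calc x ⊗ₜ y * e = (1 ⊗ₜ y) * ((x ⊗ₜ 1) * e) := by simp [← mul_assoc]
        _ = (1 ⊗ₜ Algebra.TensorProduct.lmul' A (x ⊗ₜ y)) * e := by
          rw [he, ← mul_assoc]; simp [mul_comm y x]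
    | add z w hz hw => simp [add_mul, TensorProduct.tmul_add, hz, hw]
  rw [key, hz, Algebra.algebraMap_eq_smul_one, TensorProduct.tmul_smul, smul_mul_assoc,
    ← Algebra.TensorProduct.one_def, one_mul]

variable {A A' B B' : Type*} [CommRing A] [CommRing A'] [CommRing B] [CommRing B'] [Algebra A B]
  [Algebra B B'] [Algebra A' B'] [Algebra A B'] [IsScalarTower A B B'] [Algebra A A']
  [IsScalarTower A A' B']

variable (A' B' A B) in
/-- The ring homomorphism `B ⊗[A] B → B' ⊗[A'] B'` induced by a commutative square of rings
`A → A' → B'`, `A → B → B'`. -/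
noncomputable def tensorSquareMap : B ⊗[A] B →ₐ[A] B' ⊗[A'] B' :=
  (Algebra.TensorProduct.mapOfCompatibleSMul A' A A B' B').comp
    (Algebra.TensorProduct.map (IsScalarTower.toAlgHom A B B') (IsScalarTower.toAlgHom A B B'))

@[simp]
theorem tensorSquareMap_tmul (x y : B) : tensorSquareMap A A' B B' (x ⊗ₜ y) =
    algebraMap B B' x ⊗ₜ[A'] algebraMap B B' y := by
  simp [tensorSquareMap]

theorem lmul'_tensorSquareMap (z : B ⊗[A] B) :
    Algebra.TensorProduct.lmul' A' (tensorSquareMap A A' B B' z) =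
      algebraMap B B' (Algebra.TensorProduct.lmul' A z) := by
  induction z with
  | zero => simp
  | tmul x y => simp
  | add x y hx hy => simp [hx, hy]

theorem lid_rTensor_tensorSquareMap {φ : Module.Dual A B} {φ' : Module.Dual A' B'}
    (h : ∀ b, φ' (algebraMap B B' b) = algebraMap A A' (φ b)) (z : B ⊗[A] B) :
    TensorProduct.lid A' B' (φ'.rTensor B' (tensorSquareMap A A' B B' z)) =
      algebraMap B B' (TensorProduct.lid A B (φ.rTensor B z)) := by
  induction z with
  | zero => simp
  | tmul x y => simp [h, Algebra.smul_def, ← IsScalarTower.algebraMap_apply]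
  | add x y hx hy => simp [hx, hy]

theorem tmul_one_mul_tensorSquareMap
    (hspan : Submodule.span A' (Set.range (algebraMap B B')) = ⊤) {e : B ⊗[A] B}
    (he : ∀ b, (b ⊗ₜ 1) * e = (1 ⊗ₜ b) * e) (b' : B') :
    (b' ⊗ₜ 1) * tensorSquareMap A A' B B' e = (1 ⊗ₜ b') * tensorSquareMap A A' B B' e := by
  induction hspan ▸ Submodule.mem_top (x := b') using Submodule.span_induction with
  | mem _ hb' =>
    obtain ⟨b, rfl⟩ := hb'
    simpa using congrArg (tensorSquareMap A A' B B') (he b)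
  | zero => simp
  | add x y _ _ hx hy => simp only [TensorProduct.add_tmul, TensorProduct.tmul_add, add_mul, hx, hy]
  | smul a' x _ hx =>
    rw [← TensorProduct.smul_tmul', TensorProduct.tmul_smul, smul_mul_assoc, smul_mul_assoc, hx]

theorem noetherDifferent_le_comap
    (hspan : Submodule.span A' (Set.range (algebraMap B B')) = ⊤) :
    noetherDifferent A B ≤ (noetherDifferent A' B').comap (algebraMap B B') := by
  intro c hc
  obtain ⟨e, he, rfl⟩ := mem_noetherDifferent_iff.mp hc
  exact mem_noetherDifferent_iff.mpr ⟨_, tmul_one_mul_tensorSquareMap hspan he,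
    lmul'_tensorSquareMap e⟩

variable {t : A}

theorem exists_smul_eq_pow_smul (hA : IsTorsionFreeCompletion t (Algebra.linearMap A A'))
    (hB : IsTorsionFreeCompletion t (IsScalarTower.toAlgHom A B B').toLinearMap)
    {a : A} (ha : a ∈ finiteProjectivityIdeal A B) {n : ℕ} {z : B ⊗[A] B} {w' : B' ⊗[A'] B'}
    (hz : tensorSquareMap A A' B B' z = t ^ n • w') : ∃ w : B ⊗[A] B, a • z = t ^ n • w := by
  obtain ⟨m, φ, x, h⟩ := mem_finiteProjectivityIdeal_iff_exists_sum.mp ha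
  choose φ' hφ' using fun i ↦ hA.exists_dual_extension hB (φ i)
  have hdvd (i : Fin m) : algebraMap B B' (TensorProduct.lid A B ((φ i).rTensor B z)) =
      t ^ n • TensorProduct.lid A' B' ((φ' i).rTensor B' w') := by
    rw [← lid_rTensor_tensorSquareMap (hφ' i), hz, ← algebraMap_smul A', map_smul, map_smul,
      algebraMap_smul]
  choose w hw using fun i ↦ hB.exists_eq_smul n _ _ (hdvd i)
  refine ⟨∑ i, x i ⊗ₜ w i, ?_⟩
  simp only [← sum_tmul_lid_rTensor h z, hw, TensorProduct.tmul_smul, Finset.smul_sum]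

theorem mul_mul_mem_noetherDifferent (hA : IsTorsionFreeCompletion t (Algebra.linearMap A A'))
    (hB : IsTorsionFreeCompletion t (IsScalarTower.toAlgHom A B B').toLinearMap)
    (hspan : Submodule.span A' (Set.range (algebraMap B B')) = ⊤) {n : ℕ}
    (ht : algebraMap A B (t ^ n) ∈ noetherDifferent A B) {a b c : A}
    (ha : a ∈ finiteProjectivityIdeal A B) (hb : b ∈ finiteProjectivityIdeal A B)
    (hc : algebraMap A' B' (algebraMap A A' c) ∈ noetherDifferent A' B') :
    algebraMap A B (a * (b * c)) ∈ noetherDifferent A B := by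
  obtain ⟨e, he, hμe⟩ := mem_noetherDifferent_iff.mp ht
  obtain ⟨u, hu, hμu⟩ := mem_noetherDifferent_iff.mp hc
  have hce : tensorSquareMap A A' B B' (c • e) = t ^ n • u := by
    have hμe' : Algebra.TensorProduct.lmul' A' (tensorSquareMap A A' B B' e) =
        algebraMap A' B' (algebraMap A A' (t ^ n)) := by
      rw [lmul'_tensorSquareMap, hμe, ← IsScalarTower.algebraMap_apply,
        ← IsScalarTower.algebraMap_apply]
    have h₁ := mul_eq_smul_of_lmul'_eq_algebraMap (tmul_one_mul_tensorSquareMap hspan he) hμu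
    have h₂ := mul_eq_smul_of_lmul'_eq_algebraMap hu hμe'
    rw [map_smul, ← algebraMap_smul A', ← h₁, mul_comm, h₂, algebraMap_smul]
  obtain ⟨w, hw⟩ := exists_smul_eq_pow_smul hA hB hb hce
  have hreg : IsSMulRegular B (t ^ n) := hB.isSMulRegular.pow n
  have hμw : Algebra.TensorProduct.lmul' A w = algebraMap A B (b * c) := hreg <| by
    have := congrArg (Algebra.TensorProduct.lmul' A) hw
    rw [map_smul, map_smul, map_smul, hμe] at this
    simp only [← this, Algebra.smul_def, map_mul]
    ring
  refine mem_noetherDifferent_iff.mpr ⟨a • w, fun x ↦ ?_, ?_⟩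
  · rw [mul_smul_comm, mul_smul_comm, ← sub_eq_zero, ← smul_sub]
    refine smul_eq_zero_of_isSMulRegular ha hreg ?_
    rw [smul_sub, ← mul_smul_comm, ← mul_smul_comm, ← hw, mul_smul_comm, mul_smul_comm,
      mul_smul_comm, mul_smul_comm, he, sub_self]
  · rw [map_smul, hμw, Algebra.smul_def, ← map_mul]

theorem le_comap_noetherDifferent_iff {R : Type*} [CommRing R] [Algebra R A] [Algebra R A']
    [Algebra R B] [Algebra R B'] [IsScalarTower R A B] [IsScalarTower R B B'] [IsScalarTower R A A']
    [IsScalarTower R A' B'] {I : Ideal R} (hI : IsIdempotentElem I) {n : ℕ}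
    (hA : IsTorsionFreeCompletion t (Algebra.linearMap A A'))
    (hB : IsTorsionFreeCompletion t (IsScalarTower.toAlgHom A B B').toLinearMap)
    (hfpi : t ^ n ∈ finiteProjectivityIdeal A B)
    (hdiff : algebraMap A B (t ^ n) ∈ noetherDifferent A B)
    (h : I ≤ (finiteProjectivityIdeal A B).comap (algebraMap R A)) :
    I ≤ (noetherDifferent A B).comap (algebraMap R B) ↔
      I ≤ (noetherDifferent A' B').comap (algebraMap R B') := by
  have hspan := span_range_eq_top_of_pow_mem hA hB hfpi
  constructor <;> intro h'
  · rw [IsScalarTower.algebraMap_eq R B B', ← Ideal.comap_comap]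
    exact h'.trans (Ideal.comap_mono (noetherDifferent_le_comap hspan))
  · refine le_of_forall_mul_mul_mem hI fun a ha b hb c hc ↦ ?_
    rw [Ideal.mem_comap, IsScalarTower.algebraMap_apply R A B, map_mul (algebraMap R A),
      map_mul (algebraMap R A)]
    refine mul_mul_mem_noetherDifferent hA hB hspan hdiff (h ha) (h hb) ?_
    rw [← IsScalarTower.algebraMap_apply R A A', ← IsScalarTower.algebraMap_apply R A' B']
    exact h' hc

end DifferentCompletion

section Trace

open Polynomial

variable {A B ι : Type*} [CommRing A] [CommRing B] [Algebra A B] [Fintype ι]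

theorem charpoly_dvd_pow_of_aeval_eq_zero [DecidableEq ι] {Ψ : Matrix ι ι A} {p : A[X]}
    (h : aeval Ψ p = 0) : Ψ.charpoly ∣ p ^ Fintype.card ι := by
  have hdvd : X - C X ∣ p.map C - C p := by
    simpa [eval_map, eval₂_C_X] using X_sub_C_dvd_sub_C_eval (a := X) (p := p.map C)
  have hmat : aeval (C.mapMatrix Ψ) (p.map C) = 0 := by
    have := congrArg (CAlgHom (R := A) (A := A)).mapMatrix h
    rw [map_zero, ← aeval_algHom_apply] at this
    rw [← algebraMap_eq, aeval_map_algebraMap]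
    exact this
  have hcharmatrix : Ψ.charmatrix ∣ Matrix.scalar ι p := by
    have := map_dvd (aeval (R := A[X]) (C.mapMatrix Ψ)) hdvd
    rw [map_sub, map_sub, aeval_X, aeval_C, aeval_C, hmat, zero_sub, ← neg_sub, neg_dvd,
      dvd_neg] at this
    exact this
  simpa [Matrix.charpoly] using map_dvd Matrix.detMonoidHom hcharmatrix

theorem isIntegral_trace {R : Type*} [CommRing R] [Algebra R A] [DecidableEq ι] {Ψ : Matrix ι ι A}
    (h : IsIntegral R Ψ) : IsIntegral R Ψ.trace := by
  obtain ⟨p, hp, hΨ⟩ := h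
  cases isEmpty_or_nonempty ι with
  | inl _ => simpa [Matrix.trace] using isIntegral_zero
  | inr _ =>
    rw [Matrix.trace_eq_neg_charpoly_coeff]
    refine (isIntegral_coeff_of_dvd (p ^ Fintype.card ι) _ (hp.pow _) Ψ.charpoly_monic ?_ _).neg
    rw [Polynomial.map_pow]
    exact charpoly_dvd_pow_of_aeval_eq_zero (by rwa [aeval_map_algebraMap])

/-- The matrix of multiplication by `b` with respect to a dual basis `φ`, `x` of the `A`-module
`B`. -/
def mulMatrix (φ : ι → Module.Dual A B) (x : ι → B) : B →ₗ[A] Matrix ι ι A where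
  toFun b := .of fun i j ↦ φ i (b * x j)
  map_add' b c := by ext; simp [add_mul]
  map_smul' a b := by ext; simp

/-- The trace form of an algebra whose underlying module has the dual basis `φ`, `x`;
`Algebra.trace` is only meaningful for free modules. -/
def dualBasisTrace (φ : ι → Module.Dual A B) (x : ι → B) : Module.Dual A B :=
  Matrix.traceLinearMap ι A A ∘ₗ mulMatrix φ x

variable {φ : ι → Module.Dual A B} {x : ι → B}

theorem mulMatrix_mul (h : ∀ b, ∑ i, φ i b • x i = b) (b c : B) :
    mulMatrix φ x (b * c) = mulMatrix φ x b * mulMatrix φ x c := by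
  ext i j
  calc φ i (b * c * x j) = φ i (b * ∑ k, φ k (c * x j) • x k) := by rw [h, mul_assoc]
    _ = ∑ k, φ i (b * x k) * φ k (c * x j) := by
      simp only [Finset.mul_sum, mul_smul_comm, map_sum, map_smul, smul_eq_mul, mul_comm]

theorem isIntegral_mulMatrix {R : Type*} [CommRing R] [Algebra R A] [Algebra R B]
    [IsScalarTower R A B] [DecidableEq ι] (h : ∀ b, ∑ i, φ i b • x i = b) {b : B}
    (hb : IsIntegral R b) : IsIntegral R (mulMatrix φ x b) := by
  obtain ⟨p, hp, hpb⟩ := hb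
  -- `mulMatrix` need not map `1` to `1`, so only polynomials without constant term carry over.
  have hpow (n : ℕ) : mulMatrix φ x b ^ (n + 1) = mulMatrix φ x (b ^ (n + 1)) := by
    induction n with
    | zero => simp
    | succ n ih => rw [pow_succ, ih, ← mulMatrix_mul h, ← pow_succ]
  have hXp : aeval (mulMatrix φ x b) (X * p) = mulMatrix φ x (b * aeval b p) := by
    rw [map_mul, aeval_X, aeval_eq_sum_range, aeval_eq_sum_range]
    simp only [Finset.mul_sum, mul_smul_comm, ← pow_succ', hpow, map_sum,
      LinearMap.map_smul_of_tower]
  exact ⟨X * p, monic_X.mul hp, hXp.trans (by rw [aeval_def, hpb, mul_zero, map_zero])⟩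

theorem isIntegral_dualBasisTrace {R : Type*} [CommRing R] [Algebra R A] [Algebra R B]
    [IsScalarTower R A B] (h : ∀ b, ∑ i, φ i b • x i = b) {b : B} (hb : IsIntegral R b) :
    IsIntegral R (dualBasisTrace φ x b) := by
  classical exact isIntegral_trace (isIntegral_mulMatrix h hb)

theorem lid_rTensor_one_tmul_mul (ψ : Module.Dual A B) (b : B) (z : B ⊗[A] B) :
    TensorProduct.lid A B (ψ.rTensor B ((1 ⊗ₜ b) * z)) =
      b * TensorProduct.lid A B (ψ.rTensor B z) := by
  induction z with
  | zero => simp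
  | tmul u v => simp
  | add u v hu hv => simp only [mul_add, map_add, hu, hv]

theorem lid_rTensor_dualBasisTrace (h : ∀ b, ∑ i, φ i b • x i = b) {e : B ⊗[A] B}
    (he : ∀ b, (b ⊗ₜ 1) * e = (1 ⊗ₜ b) * e) (hμ : Algebra.TensorProduct.lmul' A e = 1) (b : B) :
    TensorProduct.lid A B ((dualBasisTrace φ x).rTensor B ((b ⊗ₜ 1) * e)) = b := by
  have htrace (z : B ⊗[A] B) : (dualBasisTrace φ x).rTensor B z =
      ∑ i, (φ i).rTensor B ((x i ⊗ₜ 1) * z) := by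
    induction z with
    | zero => simp
    | tmul u v =>
      simp [dualBasisTrace, mulMatrix, Matrix.trace, TensorProduct.sum_tmul, mul_comm]
    | add u v hu hv => simp only [mul_add, map_add, hu, hv, Finset.sum_add_distrib]
  have hsum : ∑ i, x i * TensorProduct.lid A B ((φ i).rTensor B e) = 1 := by
    have := congrArg (Algebra.TensorProduct.lmul' A (S := B))
      (sum_tmul_lid_rTensor (a := 1) (fun m ↦ (h m).trans (one_smul A m).symm) e)
    simpa [hμ] using this
  calc TensorProduct.lid A B ((dualBasisTrace φ x).rTensor B ((b ⊗ₜ 1) * e))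
      = ∑ i, b * (x i * TensorProduct.lid A B ((φ i).rTensor B e)) := by
        simp only [htrace, map_sum, he, mul_left_comm (x _ ⊗ₜ[A] (1 : B)) (1 ⊗ₜ[A] b),
          lid_rTensor_one_tmul_mul]
    _ = b := by rw [← Finset.mul_sum, hsum, mul_one]

theorem mem_finiteProjectivityIdeal_of_lid_rTensor {a : A} (ψ : Module.Dual A B) (z : B ⊗[A] B)
    (h : ∀ b, TensorProduct.lid A B (ψ.rTensor B ((b ⊗ₜ 1) * z)) = a • b) :
    a ∈ finiteProjectivityIdeal A B := by
  obtain ⟨n, u, v, rfl⟩ := TensorProduct.exists_sum_tmul_eq z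
  refine mem_finiteProjectivityIdeal_of_sum (fun i ↦ ψ ∘ₗ LinearMap.mulRight A (u i)) v fun b ↦ ?_
  simp [← h, Finset.mul_sum]

variable (A B) in
theorem exists_dualBasis [Module.Finite A B] [Module.Projective A B] :
    ∃ (n : ℕ) (φ : Fin n → Module.Dual A B) (x : Fin n → B), ∀ b, ∑ i, φ i b • x i = b := by
  obtain ⟨n, f, g, -, -, hfg⟩ := Module.Finite.exists_comp_eq_id_of_projective A B
  have h1 : (1 : A) ∈ finiteProjectivityIdeal A B :=
    mem_finiteProjectivityIdeal_iff_exists_comp.mpr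
      ⟨n, g, f, fun b ↦ (LinearMap.congr_fun hfg b).trans (one_smul A b).symm⟩
  simpa only [one_smul] using mem_finiteProjectivityIdeal_iff_exists_sum.mp h1

variable (A B) in
theorem exists_separability [Algebra.FormallyUnramified A B] [Algebra.EssFiniteType A B] :
    ∃ e : B ⊗[A] B, (∀ b, (b ⊗ₜ 1) * e = (1 ⊗ₜ b) * e) ∧ Algebra.TensorProduct.lmul' A e = 1 := by
  obtain ⟨e, he, hμ⟩ := Algebra.FormallyUnramified.iff_exists_tensorProduct.mp ‹_›
  exact ⟨e, fun b ↦ (sub_eq_zero.mp ((sub_mul _ _ _).symm.trans (he b))).symm, hμ⟩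

end Trace

section Localization

variable {A₀ B₀ A B : Type*} [CommRing A₀] [CommRing B₀] [CommRing A] [CommRing B]
  [Algebra A₀ B₀] [Algebra A₀ A] [Algebra B₀ B] [Algebra A B] [Algebra A₀ B]
  [IsScalarTower A₀ A B] [IsScalarTower A₀ B₀ B]

variable (A) in
theorem exists_isIntegral_pow_smul_of_fg [Algebra.IsIntegral A B] (t : A₀)
    [IsLocalization.Away t A] {N : Submodule A₀ B} (hN : N.FG) :
    ∃ m : ℕ, ∀ x ∈ N, IsIntegral A₀ (t ^ m • x) := by
  obtain ⟨S, rfl⟩ := hN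
  choose m hm using fun x : B ↦ show ∃ m : ℕ, IsIntegral A₀ (t ^ m • x) by
    obtain ⟨⟨_, m, rfl⟩, hm⟩ := IsIntegral.exists_multiple_integral_of_isLocalization
      (Submonoid.powers t) (Rₘ := A) x (Algebra.IsIntegral.isIntegral _)
    exact ⟨m, hm⟩
  let M := S.sup m
  have hle : Submodule.span A₀ (S : Set B) ≤
      (Subalgebra.toSubmodule (integralClosure A₀ B)).comap (LinearMap.lsmul A₀ B (t ^ M)) := by
    refine Submodule.span_le.mpr fun x hx ↦ show IsIntegral A₀ (t ^ M • x) from ?_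
    have hM : m x ≤ M := Finset.le_sup hx
    rw [← Nat.sub_add_cancel hM, pow_add, mul_smul]
    exact (hm x).smul _
  exact ⟨M, fun x hx ↦ hle hx⟩

variable (A) in
theorem IsAlmostIntegralElement.isIntegral_smul [Algebra.IsIntegral A B] (t : A₀)
    [IsLocalization.Away t A] {b : B} (hb : IsAlmostIntegralElement A₀ b) :
    IsIntegral A₀ (t • b) := by
  obtain ⟨N, hN, hbN⟩ := hb
  obtain ⟨m, hm⟩ := exists_isIntegral_pow_smul_of_fg A t hN
  refine IsIntegral.of_pow (n := m + 1) m.succ_pos ?_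
  rw [smul_pow, pow_succ', mul_smul]
  exact (hm _ (hbN (Submodule.subset_span ⟨m + 1, rfl⟩))).smul t

variable (t : A₀) [IsLocalization.Away (algebraMap A₀ B₀ t) B]

theorem exists_algebraMap_eq_pow_smul (b : B) :
    ∃ (n : ℕ) (b₀ : B₀), algebraMap B₀ B b₀ = t ^ n • b := by
  obtain ⟨n, b₀, h⟩ := IsLocalization.Away.surj (algebraMap A₀ B₀ t) b
  refine ⟨n, b₀, ?_⟩
  rw [← h, mul_comm, ← map_pow, ← map_pow, ← IsScalarTower.algebraMap_apply, Algebra.smul_def]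

theorem exists_tensorSquareMap_eq_pow_smul (z : B ⊗[A] B) :
    ∃ (n : ℕ) (z₀ : B₀ ⊗[A₀] B₀), tensorSquareMap A₀ A B₀ B z₀ = t ^ n • z := by
  induction z with
  | zero => exact ⟨0, 0, by simp⟩
  | tmul x y =>
    obtain ⟨m, x₀, hx⟩ := exists_algebraMap_eq_pow_smul (B₀ := B₀) t x
    obtain ⟨n, y₀, hy⟩ := exists_algebraMap_eq_pow_smul (B₀ := B₀) t y
    refine ⟨m + n, x₀ ⊗ₜ y₀, ?_⟩
    simp only [tensorSquareMap_tmul, hx, hy, ← algebraMap_smul A (_ : A₀), TensorProduct.tmul_smul,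
      ← TensorProduct.smul_tmul', smul_smul, map_pow, ← pow_add, add_comm]
  | add x y hx hy =>
    obtain ⟨m, x₀, hx⟩ := hx
    obtain ⟨n, y₀, hy⟩ := hy
    refine ⟨m + n, t ^ n • x₀ + t ^ m • y₀, ?_⟩
    simp only [map_add, map_smul, hx, hy, smul_smul, ← pow_add, smul_add, add_comm n m]

variable [IsLocalization.Away t A]

include t in
variable (A B) in
theorem exists_dual_localization (φ : Module.Dual A₀ B₀) :
    ∃ φ' : Module.Dual A B, ∀ b, φ' (algebraMap B₀ B b) = algebraMap A₀ A (φ b) := by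
  have : IsLocalization (Algebra.algebraMapSubmonoid B₀ (Submonoid.powers t)) B := by
    rw [Algebra.algebraMapSubmonoid_powers]; infer_instance
  let j := (IsScalarTower.toAlgHom A₀ B₀ B).toLinearMap
  have : IsLocalizedModule (Submonoid.powers t) j := isLocalizedModule_iff_isLocalization.mpr this
  exact ⟨IsLocalizedModule.mapExtendScalars (Submonoid.powers t) j (Algebra.linearMap A₀ A) A φ,
    IsLocalizedModule.map_apply (Submonoid.powers t) j (Algebra.linearMap A₀ A) φ⟩

variable {t}

include t in
theorem smul_eq_zero_of_tensorSquareMap_eq_zero (hB : Function.Injective (algebraMap B₀ B))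
    {a : A₀} (ha : a ∈ finiteProjectivityIdeal A₀ B₀) {z : B₀ ⊗[A₀] B₀}
    (hz : tensorSquareMap A₀ A B₀ B z = 0) : a • z = 0 := by
  obtain ⟨m, φ, x, h⟩ := mem_finiteProjectivityIdeal_iff_exists_sum.mp ha
  have hφ (i : Fin m) : TensorProduct.lid A₀ B₀ ((φ i).rTensor B₀ z) = 0 := by
    obtain ⟨φ', hφ'⟩ := exists_dual_localization A B t (φ i)
    refine hB ((lid_rTensor_tensorSquareMap hφ' z).symm.trans ?_)
    rw [hz, map_zero, map_zero, map_zero]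
  simp only [← sum_tmul_lid_rTensor h z, hφ, TensorProduct.tmul_zero, Finset.sum_const_zero]

variable (A B) in
theorem exists_mul_pow_mem_noetherDifferent [Algebra.FormallyUnramified A B]
    [Algebra.EssFiniteType A B] (hB : Function.Injective (algebraMap B₀ B)) {a : A₀}
    (ha : a ∈ finiteProjectivityIdeal A₀ B₀) :
    ∃ n : ℕ, algebraMap A₀ B₀ (a * t ^ n) ∈ noetherDifferent A₀ B₀ := by
  obtain ⟨e, he, hμ⟩ := exists_separability A B
  obtain ⟨n, e₀, he₀⟩ := exists_tensorSquareMap_eq_pow_smul (B₀ := B₀) t e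
  refine ⟨n, mem_noetherDifferent_iff.mpr ⟨a • e₀, fun b ↦ ?_, ?_⟩⟩
  · rw [mul_smul_comm, mul_smul_comm, ← sub_eq_zero, ← smul_sub]
    refine smul_eq_zero_of_tensorSquareMap_eq_zero (t := t) (A := A) hB ha ?_
    simp only [map_sub, map_mul, tensorSquareMap_tmul, map_one, he₀, mul_smul_comm, he, sub_self]
  · have hμ₀ : Algebra.TensorProduct.lmul' A₀ e₀ = algebraMap A₀ B₀ (t ^ n) := hB <| by
      rw [← lmul'_tensorSquareMap (A' := A), he₀, ← algebraMap_smul A, map_smul, hμ,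
        algebraMap_smul, ← IsScalarTower.algebraMap_apply, Algebra.algebraMap_eq_smul_one]
    rw [map_smul, hμ₀, Algebra.smul_def, map_mul]

variable (A B) in
theorem exists_pow_mem_finiteProjectivityIdeal [Module.Finite A B] [Algebra.Etale A B]
    (hA : Function.Injective (algebraMap A₀ A)) (hB : Function.Injective (algebraMap B₀ B))
    {c : ℕ} (hc : ∀ x : A, IsIntegral A₀ x → ∃ a, algebraMap A₀ A a = t ^ c • x)
    (hint : ∀ b : B₀, IsAlmostIntegralElement A₀ (algebraMap B₀ B b)) :
    ∃ n : ℕ, t ^ n ∈ finiteProjectivityIdeal A₀ B₀ := by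
  have := Module.FinitePresentation.of_finite_of_finitePresentation A B
  have : Module.Projective A B := Module.Flat.projective_of_finitePresentation
  obtain ⟨m, φ, x, h⟩ := exists_dualBasis A B
  obtain ⟨e, he, hμ⟩ := exists_separability A B
  obtain ⟨n, e₀, he₀⟩ := exists_tensorSquareMap_eq_pow_smul (B₀ := B₀) t e
  let τ : Module.Dual A B := algebraMap A₀ A (t ^ (c + 1)) • dualBasisTrace φ x
  obtain ⟨τ₀, hτ₀⟩ : ∃ τ₀ : Module.Dual A₀ B₀, ∀ b,
      τ (algebraMap B₀ B b) = algebraMap A₀ A (τ₀ b) := by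
    let g : B₀ →ₗ[A₀] A := τ.restrictScalars A₀ ∘ₗ (IsScalarTower.toAlgHom A₀ B₀ B).toLinearMap
    refine ⟨g.codRestrictOfInjective (Algebra.linearMap A₀ A) hA fun b ↦ ?_, fun b ↦
      (g.codRestrictOfInjective_comp_apply (Algebra.linearMap A₀ A) hA _ b).symm⟩
    obtain ⟨a, ha⟩ := hc _ (isIntegral_dualBasisTrace h ((hint b).isIntegral_smul A t))
    refine ⟨a, ha.trans ?_⟩
    rw [LinearMap.map_smul_of_tower, smul_smul, ← pow_succ, ← algebraMap_smul A]
    rfl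
  refine ⟨c + 1 + n, mem_finiteProjectivityIdeal_of_lid_rTensor τ₀ e₀ fun b ↦ hB ?_⟩
  rw [← lid_rTensor_tensorSquareMap hτ₀, map_mul, he₀, tensorSquareMap_tmul, map_one,
    mul_smul_comm, ← algebraMap_smul A, map_smul, map_smul, LinearMap.rTensor_smul,
    LinearMap.smul_apply, map_smul, lid_rTensor_dualBasisTrace h he hμ, smul_smul, ← map_mul,
    algebraMap_smul, ← pow_add, add_comm n, Algebra.smul_def, Algebra.smul_def, map_mul,
    ← IsScalarTower.algebraMap_apply]

end Localization

section Star

theorem associated_of_span_singleton_eq {A : Type*} [CommRing A] {s t : A}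
    (hs : s ∈ nonZeroDivisors A) (h : Ideal.span {s} = Ideal.span {t}) : Associated s t := by
  obtain ⟨c, rfl⟩ := Ideal.span_singleton_le_span_singleton.mp h.ge
  obtain ⟨d, hd⟩ := Ideal.span_singleton_le_span_singleton.mp h.le
  have hcd : c * d = 1 := (mul_cancel_left_mem_nonZeroDivisors hs).mp <| by
    rw [← mul_assoc, ← hd, mul_one]
  exact ⟨.mkOfMulEqOne c d hcd, rfl⟩

namespace IsPreuniform

variable {A₀ : Type uA} [CommRing A₀] {t : A₀} (h : IsPreuniform (Ideal.span {t}))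
include h

theorem mem_nonZeroDivisors : t ∈ nonZeroDivisors A₀ := by
  obtain ⟨s, hs, hts, -⟩ := h
  obtain ⟨u, rfl⟩ := associated_of_span_singleton_eq hs hts.symm
  exact mul_mem hs u.isUnit.mem_nonZeroDivisors

theorem exists_algebraMap_eq_pow_smul (A : Type*) [CommRing A] [Algebra A₀ A]
    [IsLocalization.Away t A] :
    ∃ c : ℕ, ∀ x : A, IsIntegral A₀ x → ∃ a, algebraMap A₀ A a = t ^ c • x := by
  obtain ⟨s, hs, hts, c, -, hc⟩ := h
  have hst := associated_of_span_singleton_eq hs hts.symm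
  have : IsLocalization.Away s A := .of_associated hst.symm
  let ψ : Localization.Away s ≃ₐ[A₀] A :=
    IsLocalization.algEquiv (Submonoid.powers s) (Localization.Away s) A
  refine ⟨c, fun x hx ↦ ?_⟩
  obtain ⟨a, ha⟩ := hc (ψ.symm x) (hx.map ψ.symm)
  have hψ : algebraMap A₀ A a = s ^ c • x := by
    simpa [Algebra.smul_def] using congrArg ψ ha
  obtain ⟨u, rfl⟩ := hst
  exact ⟨u ^ c * a, by rw [map_mul, hψ, ← Algebra.smul_def, smul_smul, mul_pow, mul_comm]⟩

end IsPreuniform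

namespace SatisfiesStar

variable {A₀ : Type uA} [CommRing A₀] {B₀ : Type uB} [CommRing B₀] {f : A₀ →+* B₀} {t : A₀}
  (h : SatisfiesStar f (Ideal.span {t}) (Ideal.span {f t}))
include h

theorem mem_nonZeroDivisors : t ∈ nonZeroDivisors A₀ ∧ f t ∈ nonZeroDivisors B₀ := by
  obtain ⟨t₁, ht₁, -, hpre, -, htor, -⟩ := h
  have ht := hpre.mem_nonZeroDivisors
  obtain ⟨u, hu⟩ := (associated_of_span_singleton_eq ht ht₁).symm
  refine ⟨ht, ?_⟩
  rw [← hu, map_mul]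
  exact mul_mem (mem_nonZeroDivisors_iff_left.mpr htor) (u.isUnit.map f).mem_nonZeroDivisors

theorem exists_pow_mem :
    letI := f.toAlgebra
    ∃ n : ℕ, t ^ n ∈ finiteProjectivityIdeal A₀ B₀ ∧
      algebraMap A₀ B₀ (t ^ n) ∈ noetherDifferent A₀ B₀ := by
  let : Algebra A₀ B₀ := f.toAlgebra
  have ht := h.mem_nonZeroDivisors.1
  obtain ⟨t₁, ht₁, -, hpre, ⟨_, _⟩, htor, hint⟩ := h
  let A := Localization.Away t₁
  let B := Localization.Away (f t₁)
  let : Algebra A B := (Localization.awayMap f t₁).toAlgebra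
  have : Module.Finite A B := ‹(Localization.awayMap f t₁).Finite›
  have : Algebra.Etale A B := ‹(Localization.awayMap f t₁).Etale›
  have : IsScalarTower A₀ A B := .of_algebraMap_eq fun x ↦ by
    rw [IsScalarTower.algebraMap_apply A₀ B₀ B]
    exact (IsLocalization.map_eq (S := A) (T := .powers (f t₁))
      (Submonoid.powers_le.mpr (Submonoid.mem_powers (f t₁))) x).symm
  have hA : Function.Injective (algebraMap A₀ A) := by
    refine IsLocalization.injective A (M := Submonoid.powers t₁) (Submonoid.powers_le.mpr ?_)
    exact (ht₁ ▸ hpre).mem_nonZeroDivisors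
  have hB : Function.Injective (algebraMap B₀ B) :=
    IsLocalization.injective B (M := Submonoid.powers (f t₁))
      (Submonoid.powers_le.mpr (mem_nonZeroDivisors_iff_left.mpr htor))
  have : IsLocalization.Away (algebraMap A₀ B₀ t₁) B := Localization.isLocalization
  obtain ⟨c, hc⟩ := (ht₁ ▸ hpre).exists_algebraMap_eq_pow_smul A
  obtain ⟨k, hk⟩ := exists_pow_mem_finiteProjectivityIdeal A B (t := t₁) hA hB hc hint
  obtain ⟨n, hn⟩ := exists_mul_pow_mem_noetherDifferent A B (t := t₁) hB hk
  have hdvd : t₁ ^ (k + n) ∣ t ^ (k + n) :=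
    pow_dvd_pow_of_dvd (associated_of_span_singleton_eq ht ht₁).symm.dvd _
  rw [← pow_add] at hn
  exact ⟨k + n, Ideal.mem_of_dvd _ ((pow_dvd_pow t₁ (k.le_add_right n)).trans hdvd) hk,
    Ideal.mem_of_dvd _ (map_dvd _ hdvd) hn⟩

end SatisfiesStar

end Star

section AdicCompletion

variable {A : Type*} [CommRing A] {t : A}

namespace IsTorsionFreeCompletion

theorem adicCompletion_of {N : Type*} [AddCommGroup N] [Module A N] (ht : IsSMulRegular N t) :
    IsTorsionFreeCompletion t (AdicCompletion.of (Ideal.span {t}) N) where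
  isSMulRegular := ht
  isAdicComplete := AdicCompletion.isAdicComplete (Submodule.fg_span_singleton t)
  exists_eq_add n x' := by
    obtain ⟨x, hx⟩ := Submodule.mkQ_surjective _ (AdicCompletion.eval _ N n x')
    have hker : x' - AdicCompletion.of (Ideal.span {t}) N x ∈
        (Ideal.span {t} ^ n • ⊤ : Submodule A (AdicCompletion (Ideal.span {t}) N)) := by
      rw [AdicCompletion.pow_smul_top_eq_ker_eval (Submodule.fg_span_singleton t),
        LinearMap.mem_ker, map_sub, AdicCompletion.eval_of, hx, sub_self]
    obtain ⟨y', hy'⟩ := mem_span_singleton_pow_smul_top.mp hker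
    exact ⟨x, y', by rw [← hy', add_sub_cancel]⟩
  exists_eq_smul n x y' h := by
    have hker : AdicCompletion.of (Ideal.span {t}) N x ∈
        LinearMap.ker (AdicCompletion.eval (Ideal.span {t}) N n) := by
      rw [← AdicCompletion.pow_smul_top_eq_ker_eval (Submodule.fg_span_singleton t)]
      exact mem_span_singleton_pow_smul_top.mpr ⟨y', h⟩
    rw [LinearMap.mem_ker, AdicCompletion.eval_of, Submodule.mkQ_apply,
      Submodule.Quotient.mk_eq_zero] at hker
    exact mem_span_singleton_pow_smul_top.mp hker

theorem restrictScalars {B N N' : Type*} [CommRing B] [Algebra A B] [AddCommGroup N]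
    [AddCommGroup N'] [Module A N] [Module B N] [IsScalarTower A B N] [Module A N'] [Module B N']
    [IsScalarTower A B N'] {j : N →ₗ[B] N'}
    (hj : IsTorsionFreeCompletion (algebraMap A B t) j) :
    IsTorsionFreeCompletion t (j.restrictScalars A) where
  isSMulRegular := by simpa only [IsSMulRegular, algebraMap_smul] using hj.isSMulRegular
  isAdicComplete := by
    have := hj.isAdicComplete
    rwa [← IsAdicComplete.map_algebraMap_iff (S := B), Ideal.map_span, Set.image_singleton]
  exists_eq_add n x' := by
    simpa only [← map_pow, algebraMap_smul, LinearMap.coe_restrictScalars] using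
      hj.exists_eq_add n x'
  exists_eq_smul n x y' h := by
    simpa only [← map_pow, algebraMap_smul] using
      hj.exists_eq_smul n x y' (by rwa [← map_pow, algebraMap_smul])

end IsTorsionFreeCompletion

theorem completionMap_algebraMap {R A₀ B₀ : Type*} [CommRing R] [CommRing A₀] [CommRing B₀]
    [Algebra R A₀] [Algebra R B₀] (f : A₀ →ₐ[R] B₀) (t a : A₀) :
    completionMap f t (algebraMap A₀ _ a) = algebraMap B₀ _ (f a) :=
  AdicCompletion.ext_evalₐ fun _ ↦ rfl

end AdicCompletion

end AlmostPurity

open AlmostPurity in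
theorem mainTheorem2_general {R : Type uR} [CommRing R] {I : Ideal R} (hI : IsIdempotentElem I)
    {A₀ : Type uA} [CommRing A₀] [Algebra R A₀] {B₀ : Type uB} [CommRing B₀] [Algebra R B₀]
    (f₀ : A₀ →ₐ[R] B₀) (t : A₀)
    (hf₀ : SatisfiesStar (f₀ : A₀ →+* B₀) (Ideal.span {t}) (Ideal.span {f₀ t})) :
    (IsAlmostFinitelyGeneratedProjective I f₀ ↔
      IsAlmostFinitelyGeneratedProjective I (completionMap f₀ t)) ∧
    (IsAlmostFiniteEtale I f₀ ↔ IsAlmostFiniteEtale I (completionMap f₀ t)) := by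
  simp only [isAlmostFinitelyGeneratedProjective_iff _ hI, isAlmostFiniteEtale_iff _ hI]
  let : Algebra A₀ B₀ := f₀.toRingHom.toAlgebra
  let A' := AdicCompletion (Ideal.span {t}) A₀
  let B' := AdicCompletion (Ideal.span {algebraMap A₀ B₀ t}) B₀
  let f' : A' →ₐ[R] B' := completionMap f₀ t
  let : Algebra A' B' := f'.toRingHom.toAlgebra
  have : IsScalarTower R A₀ B₀ := .of_algebraMap_eq fun r ↦ (f₀.commutes r).symm
  have : IsScalarTower R A' B' := .of_algebraMap_eq fun r ↦ (f'.commutes r).symm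
  have : IsScalarTower A₀ A' B' :=
    .of_algebraMap_eq fun a ↦ (completionMap_algebraMap f₀ t a).symm
  obtain ⟨htA, htB⟩ := hf₀.mem_nonZeroDivisors
  obtain ⟨n, hfpi, hdiff⟩ := hf₀.exists_pow_mem
  have hA : IsTorsionFreeCompletion t (Algebra.linearMap A₀ A') :=
    .adicCompletion_of (Module.Flat.isSMulRegular_of_nonZeroDivisors htA)
  have hB : IsTorsionFreeCompletion t (IsScalarTower.toAlgHom A₀ B₀ B').toLinearMap :=
    (IsTorsionFreeCompletion.adicCompletion_of (t := algebraMap A₀ B₀ t)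
      (Module.Flat.isSMulRegular_of_nonZeroDivisors htB)).restrictScalars
  have hproj : I ≤ (finiteProjectivityIdeal A₀ B₀).comap (algebraMap R A₀) ↔
      I ≤ (finiteProjectivityIdeal A' B').comap (algebraMap R A') := by
    rw [← comap_finiteProjectivityIdeal hA hB hfpi, Ideal.comap_comap,
      IsScalarTower.algebraMap_eq R A₀ A']
  exact ⟨hproj, (and_congr_right (le_comap_noetherDifferent_iff hI hA hB hfpi hdiff)).trans
    (and_congr_left' hproj)⟩

theorem mainTheorem2 {R : Type uR} [CommRing R] (I : Ideal R) (hI : AlmostPurity.IsBasicSetup I)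
    {A₀ : Type uA} [CommRing A₀] [Algebra R A₀] {B₀ : Type uB} [CommRing B₀] [Algebra R B₀]
    (f₀ : A₀ →ₐ[R] B₀) (t : A₀)
    (hf₀ : AlmostPurity.SatisfiesStar (f₀ : A₀ →+* B₀) (Ideal.span {t}) (Ideal.span {f₀ t})) :
    (AlmostPurity.IsAlmostFinitelyGeneratedProjective I f₀ ↔
      AlmostPurity.IsAlmostFinitelyGeneratedProjective I (AlmostPurity.completionMap f₀ t)) ∧
    (AlmostPurity.IsAlmostFiniteEtale I f₀ ↔
      AlmostPurity.IsAlmostFiniteEtale I (AlmostPurity.completionMap f₀ t)) :=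
  mainTheorem2_general ((sq I).symm.trans hI.idempotent.symm) f₀ t hf₀
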